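/- **Setting.** Let $\delta>0$, $\Lambda=(-2\delta,1+2\delta)$, and let $f:\mathbb R^d\times\Lambda\to\mathbb R^d$ be Lipschitz continuous. For $\lambda\in\Lambda$ let $\phi^\lambda_t$ be the flow on $\mathbb R^d$ generated by $\dot x=f(x,\lambda)$, and for $\epsilon>0$ let $\Phi^\epsilon_t$ denote the extended slow-fast system $\dot x=f(x,\lambda)$, $\dot\lambda=\epsilon\lambda(\lambda-1)$ on $\mathbb R^d\times\Lambda$. For $K\subset\mathbb R^d$, $\mathrm{Inv}(K,\phi^\lambda)$ is the set of points whose whole $\phi^\lambda$-orbit stays in $K$; a compact set $K$ is an *isolating neighborhood* if $\mathrm{Inv}(K,\phi^\lambda)\subset\mathrm{int}\,K$, and it then *isolates* the *isolated invariant set* $\mathrm{Inv}(K,\phi^\lambda)$. Let $\alpha(x)$, $\omega(x)$ be the limit sets of $x$. A *Morse decomposition* of an isolated invariant set $S$ is a finite family of pairwise disjoint isolated invariant sets $M_p\subset S$, indexed by a finite partially ordered set $\mathcal P$, such that each $x\in S\setminus\bigcup_pM_p$ has $\omega(x)\subset M_p$, $\alpha(x)\subset M_q$ for some $p<q$. The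 *flow-defined order* $<^{\mathfrak f}$ on $\mathcal P$ is the partial order generated by the relations $p<^{\mathfrak f}q$ whenever $p\ne q$ and some $x\in S$ has $\omega(x)\subset M_p$, $\alpha(x)\subset M_q$. For $\mathcal Q\subset\mathcal P$ let $\mathfrak M_{\mathcal Q}$ be the union of the $M_p$, $p\in\mathcal Q$, and of all $x\in S$ with $\omega(x)\subset M_p$, $\alpha(x)\subset M_q$ for some $p,q\in\mathcal Q$. A set $J\subset\mathcal P$ is an *interval* if $p,q\in J$ and $p<r<q$ imply $r\in J$. **Breakdown of continuation.** Let $N\subset\mathbb R^d$ be an isolating neighborhood for $\phi^\lambda$ for every $\lambda\in\Lambda$, put $S^\lambda=\mathrm{Inv}(N,\phi^\lambda)$, and let $(\{M^\lambda_p\}_{p\in\mathcal P_\lambda},\mathcal P_\lambda)$ be a Morse decomposition of $S^\lambda$ for every $\lambda\in\Lambda$. The Morse decomposition *continues over* an interval $I$ if $\mathcal P_\lambda$ is the same partially ordered set $\mathcal P$ for all $\lambda\in I$ and, for all $p\in\mathcal P$, $\gamma\in I$, there are a relatively open interval $O\ni\gamma$ of $I$ and one compact set that is an isolating neighborhood of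 $M^\lambda_p$ for all $\lambda\in O$. Assume that for some $\lambda_0\in(0,1)$ it continues over $[0,\lambda_0)$ (with index set $\mathcal P_0$) and over $(\lambda_0,1]$ (with index set $\mathcal P_1$), but not over $[0,1]$. **Finest decomposition.** A pair of intervals $J\subset\mathcal P_0$, $J'\subset\mathcal P_1$, not both empty, is *continuable* if there are $a\in[0,\lambda_0)$, $b\in(\lambda_0,1]$ and a set $N(J,J')\subset\mathbb R^d$ that is an isolating neighborhood for all $\lambda\in[a,b]$, isolates $\mathfrak M^\lambda_J$ for $\lambda\in[a,\lambda_0)$ and isolates $\mathfrak M^\lambda_{J'}$ for $\lambda\in(\lambda_0,b]$. Any such $N(J,J')$ is called a *neighborhood of the pair*. The pair is *indecomposable* if there is no continuable pair $(K,K')$ with $K\subsetneq J$ and $K'\subsetneq J'$. Let $\{(J_i,J_i')\}_{i\in A}$ be a finest decomposition of $(\mathcal P_0,\mathcal P_1)$: a finite family of indecomposable continuable pairs such that $\mathcal P_0$ is the disjoint union of the $J_i$ and $\mathcal P_1$ is the disjoint union of the $J'_i$. **Connecting orbits.** Assume that there are $\epsilon_0\in(0,1)$, $\rho\in\mathcal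 P_1$, $\pi\in\mathcal P_0$ such that for all $\epsilon\in(0,\epsilon_0)$ there is an orbit $c_\epsilon\subset N\times\Lambda$ of $\Phi^\epsilon_t$ with $\alpha(c_\epsilon)\subset M^1_\rho\times\{1\}$ and $\omega(c_\epsilon)\subset M^0_\pi\times\{0\}$. Let $\epsilon_n\in(0,\epsilon_0)$, $\epsilon_n\to0$, be any sequence for which the closures $\overline{c_{\epsilon_n}}$ converge in the Hausdorff metric, let $\bar c$ be the limit, and put $I^\lambda=\{p\in\mathcal P_\lambda: \bar c\cap(M^\lambda_p\times\{\lambda\})\ne\varnothing\}$. **Conclusion.** There are integers $1\le l\le k$, parameters $$1=\gamma_0>\gamma_1>\dots>\gamma_{l-1}>\gamma_l=\lambda_0>\gamma_{l+1}>\dots>\gamma_k>\gamma_{k+1}=0$$ and indices $\rho=\xi_0,\xi_1,\dots,\xi_l\in\mathcal P_1$, $\xi'_l,\xi'_{l+1}\in\mathcal P_{\lambda_0}$, $\xi_{l+1},\dots,\xi_{k+1},\xi_{k+2}=\pi\in\mathcal P_0$ such that: 1. $\xi_{i+1}<^{\mathfrak f}_{\gamma_i}\xi_i$ for all $i\in\{1,\dots,k\}\setminus\{l\}$,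 and $\xi'_{l+1}\le^{\mathfrak f}_{\lambda_0}\xi'_l$, for the flow-defined orders at the parameters $\gamma_i$ and $\lambda_0$. 2. $\rho=\xi_0=\sup I^1$, $\xi_1=\inf I^1$, $\xi_{k+1}=\sup I^0$, $\pi=\xi_{k+2}=\inf I^0$, where suprema and infima are greatest and least elements for the flow-defined orders at $\lambda=1$ and $\lambda=0$. 3. Let $L^+$ be any Hausdorff limit of a sequence $M^{\lambda_n}_{\xi_l}$ with $\lambda_n\in(\lambda_0,1]$, $\lambda_n\to\lambda_0$, and $L^-$ any Hausdorff limit of a sequence $M^{\lambda_n}_{\xi_{l+1}}$ with $\lambda_n\in[0,\lambda_0)$, $\lambda_n\to\lambda_0$. Then $M^{\lambda_0}_{\xi'_l}\cap L^+\ne\varnothing$ and $M^{\lambda_0}_{\xi'_{l+1}}\cap L^-\ne\varnothing$. 4. Let $N^+$ be any neighborhood of the pair $(J_i,J'_i)$ with $\xi_l\in J'_i$, and $N^-$ any neighborhood of the pair $(J_j,J'_j)$ with $\xi_{l+1}\in J_j$. Then, for all limits $L^\pm$ as in 3, $L^+\subset\mathrm{Inv}(N^+,\phi^{\lambda_0})$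 and $L^-\subset\mathrm{Inv}(N^-,\phi^{\lambda_0})$. Moreover, $M^{\lambda_0}_{\xi'_l}$ and $L^+$ are contained in $\mathfrak M^{\lambda_0}_{\mathcal Q}$ with $\mathcal Q=\{p\in\mathcal P_{\lambda_0}: M^{\lambda_0}_p\cap N^+\ne\varnothing\}$, and $M^{\lambda_0}_{\xi'_{l+1}}$ and $L^-$ are contained in $\mathfrak M^{\lambda_0}_{\mathcal Q}$ with $\mathcal Q=\{p\in\mathcal P_{\lambda_0}: M^{\lambda_0}_p\cap N^-\ne\varnothing\}$. 5. If every Morse set $M^{\lambda_0}_p$ that meets $\mathrm{Inv}(N^+,\phi^{\lambda_0})$ is contained in $N^+$, then $M^{\lambda_0}_{\xi'_l}\subset\mathrm{Inv}(N^+,\phi^{\lambda_0})$, and both $M^{\lambda_0}_{\xi'_l}$ and every $L^+$ are contained in $\mathfrak M^{\lambda_0}_{\mathcal Q}$ with $\mathcal Q=\{p\in\mathcal P_{\lambda_0}: M^{\lambda_0}_p\subset N^+\}$. The same holds for $\xi'_{l+1}$, $L^-$, $N^-$ in place of $\xi'_l$, $L^+$, $N^+$. -/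

import Mathlib

open Set Filter Topology

namespace Conley

/-- The omega limit set of a curve: the intersection over `t` of the closures of `u [t, ∞)`. -/
def omegaSet {X : Type*} [TopologicalSpace X] (u : ℝ → X) : Set X :=
  omegaLimit atTop (fun t (_ : Unit) => u t) Set.univ

/-- The alpha limit set of a curve: the intersection over `t` of the closures of `u (-∞, -t]`. -/
def alphaSet {X : Type*} [TopologicalSpace X] (u : ℝ → X) : Set X :=
  omegaLimit atBot (fun t (_ : Unit) => u t) Set.univ

section SingleFlow

variable {X : Type*} [TopologicalSpace X] {ι : Type*}

/-- The maximal invariant set in `K`: all points of `K` whose whole orbit stays in `K`. -/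
def maxInv (φ : Flow ℝ X) (K : Set X) : Set X :=
  {x | x ∈ K ∧ ∀ t : ℝ, φ t x ∈ K}

/-- An isolating neighborhood: a compact set with maximal invariant set inside its interior. -/
def IsIsolatingNbhd (φ : Flow ℝ X) (K : Set X) : Prop :=
  IsCompact K ∧ maxInv φ K ⊆ interior K

/-- `K` is an isolating neighborhood and the set that it isolates is `S`. -/
def Isolates (φ : Flow ℝ X) (K S : Set X) : Prop :=
  IsIsolatingNbhd φ K ∧ maxInv φ K = S

/-- An isolated invariant set. -/
def IsIsolatedInvariant (φ : Flow ℝ X) (S : Set X) : Prop :=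
  ∃ K : Set X, Isolates φ K S

/-- A family of sets `M p`, indexed by a finite set `idx` of labels carrying a strict relation `lt`.
Labels are taken from a fixed type, so that index sets at different parameters can be compared. -/
structure IndexedFamily (ι : Type*) (X : Type*) where
  idx : Finset ι
  lt : ι → ι → Prop
  M : ι → Set X

/-- Points of `S` whose orbits connect `M q` (in backward time) to `M p` (in forward time). -/
def connecting (φ : Flow ℝ X) (S : Set X) (D : IndexedFamily ι X) (p q : ι) : Set X :=
  {x | x ∈ S ∧ omegaSet (fun t => φ t x) ⊆ D.M p ∧ alphaSet (fun t => φ t x) ⊆ D.M q}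

/-- `D` is a Morse decomposition of `S`. -/
structure IsMorseDecomposition (φ : Flow ℝ X) (S : Set X) (D : IndexedFamily ι X) : Prop where
  irrefl : ∀ p ∈ D.idx, ¬ D.lt p p
  trans : ∀ p ∈ D.idx, ∀ q ∈ D.idx, ∀ r ∈ D.idx, D.lt p q → D.lt q r → D.lt p r
  isolated : ∀ p ∈ D.idx, IsIsolatedInvariant φ (D.M p)
  subset : ∀ p ∈ D.idx, D.M p ⊆ S
  disjoint : ∀ p ∈ D.idx, ∀ q ∈ D.idx, p ≠ q → Disjoint (D.M p) (D.M q)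
  connects : ∀ x ∈ S, (∀ p ∈ D.idx, x ∉ D.M p) →
    ∃ p ∈ D.idx, ∃ q ∈ D.idx, D.lt p q ∧ x ∈ connecting φ S D p q

/-- One step of the flow-defined order: an orbit in `S` runs from `M q` to `M p`, `p ≠ q`. -/
def flowStep (φ : Flow ℝ X) (S : Set X) (D : IndexedFamily ι X) (p q : ι) : Prop :=
  p ∈ D.idx ∧ q ∈ D.idx ∧ p ≠ q ∧ (connecting φ S D p q).Nonempty

/-- The strict flow-defined order: the partial order generated by connecting orbits. -/
def flowLT (φ : Flow ℝ X) (S : Set X) (D : IndexedFamily ι X) (p q : ι) : Prop :=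
  Relation.TransGen (flowStep φ S D) p q

/-- The non-strict flow-defined order. -/
def flowLE (φ : Flow ℝ X) (S : Set X) (D : IndexedFamily ι X) (p q : ι) : Prop :=
  p = q ∨ flowLT φ S D p q

/-- `J` is an interval in the partially ordered index set of `D`. -/
def IsInterval (D : IndexedFamily ι X) (J : Set ι) : Prop :=
  J ⊆ (D.idx : Set ι) ∧
    ∀ p ∈ J, ∀ q ∈ J, ∀ r ∈ D.idx, D.lt p r → D.lt r q → r ∈ J

/-- The Morse sets with labels in `Q`, together with the connecting orbits in `S` between them. -/
def span (φ : Flow ℝ X) (S : Set X) (D : IndexedFamily ι X) (Q : Set ι) : Set X :=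
  (⋃ p ∈ Q, D.M p) ∪ ⋃ p ∈ Q, ⋃ q ∈ Q, connecting φ S D p q

/-- The labels of the Morse sets that meet `K`. -/
def labelsMeeting (D : IndexedFamily ι X) (K : Set X) : Set ι :=
  {p | p ∈ D.idx ∧ (D.M p ∩ K).Nonempty}

/-- The labels of the Morse sets that are contained in `K`. -/
def labelsInside (D : IndexedFamily ι X) (K : Set X) : Set ι :=
  {p | p ∈ D.idx ∧ D.M p ⊆ K}

/-- Every Morse set that meets the maximal invariant set of `K` is contained in `K`. -/
def IsAdapted (φ : Flow ℝ X) (D : IndexedFamily ι X) (K : Set X) : Prop :=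
  ∀ p ∈ D.idx, (D.M p ∩ maxInv φ K).Nonempty → D.M p ⊆ K

/-- `p` is the supremum (greatest element) of `I` for the flow-defined order. -/
def IsFlowSup (φ : Flow ℝ X) (S : Set X) (D : IndexedFamily ι X) (I : Set ι) (p : ι) : Prop :=
  p ∈ I ∧ ∀ q ∈ I, flowLE φ S D q p

/-- `p` is the infimum (least element) of `I` for the flow-defined order. -/
def IsFlowInf (φ : Flow ℝ X) (S : Set X) (D : IndexedFamily ι X) (I : Set ι) (p : ι) : Prop :=
  p ∈ I ∧ ∀ q ∈ I, flowLE φ S D p q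

end SingleFlow

section ParameterizedFlow

variable {X : Type*} [TopologicalSpace X] {ι : Type*}

/-- The isolated invariant set in `N` at the parameter `s`. -/
def slice (φ : ℝ → Flow ℝ X) (N : Set X) (s : ℝ) : Set X := maxInv (φ s) N

/-- The Morse decomposition continues over the parameter interval `I`. -/
def Continues (φ : ℝ → Flow ℝ X) (D : ℝ → IndexedFamily ι X) (I : Set ℝ) : Prop :=
  ∃ (P : Finset ι) (r : ι → ι → Prop),
    (∀ s ∈ I, (D s).idx = P ∧ ∀ p ∈ P, ∀ q ∈ P, ((D s).lt p q ↔ r p q)) ∧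
    ∀ p ∈ P, ∀ g ∈ I, ∃ (a b : ℝ) (K : Set X), a < g ∧ g < b ∧
      ∀ s ∈ I, a < s → s < b → Isolates (φ s) K ((D s).M p)

/-- Breakdown of continuation at the single parameter `s₀` (parameters range over `Λ`). -/
structure Breakdown (Λ : Set ℝ) (φ : ℝ → Flow ℝ X) (N : Set X)
    (D : ℝ → IndexedFamily ι X) (s₀ : ℝ) : Prop where
  isolating : ∀ s ∈ Λ, IsIsolatingNbhd (φ s) N
  morse : ∀ s ∈ Λ, IsMorseDecomposition (φ s) (slice φ N s) (D s)
  mem : s₀ ∈ Ioo (0 : ℝ) 1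
  left : Continues φ D (Ico 0 s₀)
  right : Continues φ D (Ioc s₀ 1)
  broken : ¬ Continues φ D (Icc 0 1)

/-- `K` is an isolating neighborhood on `[a, b] ∋ s₀` which isolates the set `M_J` on `[a, s₀)`
and the set `M_J'` on `(s₀, b]`. -/
structure IsPairNbhd (φ : ℝ → Flow ℝ X) (N : Set X) (D : ℝ → IndexedFamily ι X) (s₀ : ℝ)
    (J J' : Set ι) (K : Set X) (a b : ℝ) : Prop where
  a_mem : a ∈ Ico 0 s₀
  b_mem : b ∈ Ioc s₀ 1
  isolating : ∀ s ∈ Icc a b, IsIsolatingNbhd (φ s) K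
  left : ∀ s ∈ Ico a s₀, maxInv (φ s) K = span (φ s) (slice φ N s) (D s) J
  right : ∀ s ∈ Ioc s₀ b, maxInv (φ s) K = span (φ s) (slice φ N s) (D s) J'

/-- `(J, J')` is a continuable interval pair. -/
def IsContinuable (φ : ℝ → Flow ℝ X) (N : Set X) (D : ℝ → IndexedFamily ι X) (s₀ : ℝ)
    (J J' : Set ι) : Prop :=
  IsInterval (D 0) J ∧ IsInterval (D 1) J' ∧ (J.Nonempty ∨ J'.Nonempty) ∧
    ∃ (K : Set X) (a b : ℝ), IsPairNbhd φ N D s₀ J J' K a b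

/-- The pair has no continuable pair of strict subintervals. -/
def IsIndecomposable (φ : ℝ → Flow ℝ X) (N : Set X) (D : ℝ → IndexedFamily ι X) (s₀ : ℝ)
    (J J' : Set ι) : Prop :=
  ¬ ∃ K K' : Set ι, K ⊂ J ∧ K' ⊂ J' ∧ IsContinuable φ N D s₀ K K'

/-- A finest decomposition of the two index sets: a decomposition into continuable interval
pairs that are all indecomposable. -/
structure IsFinestDecomposition {A : Type*} (φ : ℝ → Flow ℝ X) (N : Set X)
    (D : ℝ → IndexedFamily ι X) (s₀ : ℝ) (J J' : A → Set ι) : Prop where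
  disjoint_left : ∀ i j, i ≠ j → Disjoint (J i) (J j)
  disjoint_right : ∀ i j, i ≠ j → Disjoint (J' i) (J' j)
  union_left : ⋃ i, J i = ((D 0).idx : Set ι)
  union_right : ⋃ i, J' i = ((D 1).idx : Set ι)
  continuable : ∀ i, IsContinuable φ N D s₀ (J i) (J' i)
  indecomposable : ∀ i, IsIndecomposable φ N D s₀ (J i) (J' i)

/-- The labels at the parameter `s` of the Morse sets that meet the slice of `C` at `s`. -/
def sliceLabels (D : ℝ → IndexedFamily ι X) (C : Set (X × ℝ)) (s : ℝ) : Set ι :=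
  {p | p ∈ (D s).idx ∧ ∃ x ∈ (D s).M p, (x, s) ∈ C}

end ParameterizedFlow

/-- `L` is the limit of the sequence of sets `F n` in the Hausdorff metric. -/
def IsHausdorffLimit {X : Type*} [PseudoEMetricSpace X] (F : ℕ → Set X) (L : Set X) : Prop :=
  IsClosed L ∧ Tendsto (fun n => Metric.hausdorffEDist (F n) L) atTop (𝓝 0)

/-- `L` is the Hausdorff limit of `F (s n)` for some sequence `s n` in `T` converging to `s₀`. -/
def IsLimitAlong {X : Type*} [PseudoEMetricSpace X] (T : Set ℝ) (s₀ : ℝ) (F : ℝ → Set X)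
    (L : Set X) : Prop :=
  ∃ s : ℕ → ℝ, (∀ n, s n ∈ T) ∧ Tendsto s atTop (𝓝 s₀) ∧ IsHausdorffLimit (fun n => F (s n)) L

/-- The phase space of dimension `d`. -/
abbrev Phase (d : ℕ) : Type := EuclideanSpace ℝ (Fin d)

/-- `φ s` is the flow generated by `x' = f (x, s)`, for every parameter `s` in `Λ`. -/
def IsGeneratedBy {d : ℕ} (Λ : Set ℝ) (f : Phase d × ℝ → Phase d)
    (φ : ℝ → Flow ℝ (Phase d)) : Prop :=
  ∀ s ∈ Λ, ∀ (x : Phase d) (t : ℝ), HasDerivAt (fun τ => φ s τ x) (f (φ s t x, s)) t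

/-- `c` parameterizes an orbit of the extended slow-fast system `x' = f (x, s)`,
`s' = ε * s * (s - 1)` in `N × Λ`, connecting `R × {1}` (in backward time) to `B × {0}`
(in forward time). -/
structure IsConnectingOrbit {d : ℕ} (Λ : Set ℝ) (f : Phase d × ℝ → Phase d) (N : Set (Phase d))
    (ε : ℝ) (R B : Set (Phase d)) (c : ℝ → Phase d × ℝ) : Prop where
  solution : ∀ t : ℝ, HasDerivAt c (f (c t), ε * (c t).2 * ((c t).2 - 1)) t
  mem : ∀ t : ℝ, c t ∈ N ×ˢ Λ
  alpha : alphaSet c ⊆ R ×ˢ {(1 : ℝ)}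
  omega : omegaSet c ⊆ B ×ˢ {(0 : ℝ)}

end Conley

/-! On bounded time intervals the parameter of a slow orbit barely moves, so wherever it tends to
`g` the orbit shadows the frozen flow `φ g` (Gronwall, `tendsto_flow_of_drift`). Hence each slice of
the limit `C` over `[0, 1]` is a closed invariant subset of `N`, to which the Morse decomposition at
that parameter applies.

The central fact is `SlowFamily.flowLE_of_tendsto_atTop`: across time gaps tending to infinity, slow
curves can only descend in the flow-defined order. The labels met by one slice are therefore totally
ordered, and each slice has a greatest label `top` and a least label `bot`. Since the parameter
decreases in time, slices just right of `g` are traversed before points of the slice at `g`, and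
slices just left of `g` after them. Monotonicity then forces the former to accumulate only on the
Morse set of `top g` and the latter only on that of `bot g` (`IsSlowLimit.eventually_right`,
`IsSlowLimit.eventually_left`).

Where the decomposition continues, an invariant set close to a Morse set lies inside the continued
Morse set. So `top` and `bot` are constant and equal on each side near any parameter of the
continuation interval, and at an interior jump the label drops strictly. A finite order allows
finitely many drops (`exists_jump_chain`). The chain from `1` down to `s₀` and the mirrored chain
from `0` up to `s₀` are joined at `s₀`, where only the accumulation statements survive: the two
labels there are `top s₀` and `bot s₀`, and everything said about one-sided limits follows by
passing orbits to the limit (`IsOneSidedApproach.pair_inclusions`). -/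

namespace Conley

/-! ### Limit sets of curves in a compact set. -/

section LimitSets

variable {X : Type*} [TopologicalSpace X] {u : ℝ → X} {N U : Set X}

theorem eventually_mem_of_omegaSet_subset [T2Space X] (hN : IsCompact N) (hu : ∀ t, u t ∈ N)
    (hU : IsOpen U) (h : omegaSet u ⊆ U) : ∀ᶠ t in atTop, u t ∈ U :=
  (eventually_mapsTo_of_isCompact_absorbing_of_isOpen_of_omegaLimit_subset atTop
    (fun t (_ : Unit) => u t) Set.univ hN (Eventually.of_forall fun t _ _ => hu t) hU h).mono
    fun _ ht => ht (mem_univ ())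

theorem eventually_mem_of_alphaSet_subset [T2Space X] (hN : IsCompact N) (hu : ∀ t, u t ∈ N)
    (hU : IsOpen U) (h : alphaSet u ⊆ U) : ∀ᶠ t in atBot, u t ∈ U :=
  (eventually_mapsTo_of_isCompact_absorbing_of_isOpen_of_omegaLimit_subset atBot
    (fun t (_ : Unit) => u t) Set.univ hN (Eventually.of_forall fun t _ _ => hu t) hU h).mono
    fun _ ht => ht (mem_univ ())

theorem omegaSet_nonempty [T2Space X] (hN : IsCompact N) (hu : ∀ t, u t ∈ N) :
    (omegaSet u).Nonempty :=
  nonempty_omegaLimit_of_isCompact_absorbing atTop (fun t (_ : Unit) => u t) Set.univ hN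
    ⟨univ, univ_mem, closure_minimal (by rintro _ ⟨t, -, _, -, rfl⟩; exact hu t) hN.isClosed⟩
    univ_nonempty

theorem alphaSet_nonempty [T2Space X] (hN : IsCompact N) (hu : ∀ t, u t ∈ N) :
    (alphaSet u).Nonempty :=
  nonempty_omegaLimit_of_isCompact_absorbing atBot (fun t (_ : Unit) => u t) Set.univ hN
    ⟨univ, univ_mem, closure_minimal (by rintro _ ⟨t, -, _, -, rfl⟩; exact hu t) hN.isClosed⟩
    univ_nonempty

theorem omegaSet_subset_of_eventually (hU : IsClosed U) (h : ∀ᶠ t in atTop, u t ∈ U) :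
    omegaSet u ⊆ U :=
  (omegaLimit_subset_closure_image2 _ _ _ h).trans
    (closure_minimal (by rintro _ ⟨t, ht, _, -, rfl⟩; exact ht) hU)

theorem alphaSet_subset_of_eventually (hU : IsClosed U) (h : ∀ᶠ t in atBot, u t ∈ U) :
    alphaSet u ⊆ U :=
  (omegaLimit_subset_closure_image2 _ _ _ h).trans
    (closure_minimal (by rintro _ ⟨t, ht, _, -, rfl⟩; exact ht) hU)

end LimitSets

/-! ### Maximal invariant sets. -/

section Invariance

variable {X : Type*} [TopologicalSpace X] {φ : Flow ℝ X} {N K S : Set X} {x : X}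

theorem maxInv_subset (φ : Flow ℝ X) (N : Set X) : maxInv φ N ⊆ N := fun _ hx => hx.1

theorem flow_mem_maxInv (hx : x ∈ maxInv φ N) (t : ℝ) : φ t x ∈ maxInv φ N :=
  ⟨hx.2 t, fun s => by rw [← φ.map_add]; exact hx.2 _⟩

theorem subset_maxInv (hS : S ⊆ N) (h : ∀ x ∈ S, ∀ t, φ t x ∈ S) : S ⊆ maxInv φ N :=
  fun x hx => ⟨hS hx, fun t => hS (h x hx t)⟩

theorem isClosed_maxInv (hN : IsClosed N) : IsClosed (maxInv φ N) := by
  have : maxInv φ N = N ∩ ⋂ t : ℝ, {x | φ t x ∈ N} := by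
    ext x; simp [maxInv]
  rw [this]
  exact hN.inter (isClosed_iInter fun t => hN.preimage (φ.continuous_toFun t))

theorem isCompact_maxInv [T2Space X] (hN : IsCompact N) : IsCompact (maxInv φ N) :=
  hN.of_isClosed_subset (isClosed_maxInv hN.isClosed) (maxInv_subset φ N)

theorem IsIsolatedInvariant.isCompact [T2Space X] (h : IsIsolatedInvariant φ S) :
    IsCompact S := by
  obtain ⟨K, hK, rfl⟩ := h
  exact isCompact_maxInv hK.1

theorem IsIsolatedInvariant.flow_mem (h : IsIsolatedInvariant φ S) (hx : x ∈ S) (t : ℝ) :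
    φ t x ∈ S := by
  obtain ⟨K, hK, rfl⟩ := h
  exact flow_mem_maxInv hx t

end Invariance

/-! ### Morse decompositions and the flow-defined order. -/

section Morse

variable {X : Type*} [TopologicalSpace X] {ι : Type*} {φ : Flow ℝ X} {N : Set X}
  {D : IndexedFamily ι X} {x : X} {p q r : ι}

/-- The axiom `connects` covers only points off the Morse sets. A point inside `M p` keeps both
limit sets there, so it is labelled by `p` twice. -/
theorem IsMorseDecomposition.exists_labels [T2Space X] {S : Set X}
    (hD : IsMorseDecomposition φ S D) (hx : x ∈ S) :
    ∃ p ∈ D.idx, ∃ q ∈ D.idx, x ∈ connecting φ S D p q := by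
  by_cases h : ∀ p ∈ D.idx, x ∉ D.M p
  · obtain ⟨p, hp, q, hq, -, h⟩ := hD.connects x hx h
    exact ⟨p, hp, q, hq, h⟩
  · push Not at h
    obtain ⟨p, hp, hxp⟩ := h
    have hi := hD.isolated p hp
    exact ⟨p, hp, p, hp, hx,
      omegaSet_subset_of_eventually hi.isCompact.isClosed
        (Eventually.of_forall fun t => hi.flow_mem hxp t),
      alphaSet_subset_of_eventually hi.isCompact.isClosed
        (Eventually.of_forall fun t => hi.flow_mem hxp t)⟩

theorem IsMorseDecomposition.eq_of_mem (hD : IsMorseDecomposition φ N D)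
    (hp : p ∈ D.idx) (hq : q ∈ D.idx) (hxp : x ∈ D.M p) (hxq : x ∈ D.M q) : p = q := by
  by_contra hne
  exact disjoint_left.1 (hD.disjoint p hp q hq hne) hxp hxq

theorem flowLE_trans {S : Set X} (h : flowLE φ S D p q) (h' : flowLE φ S D q r) :
    flowLE φ S D p r := by
  rcases h with rfl | h
  · exact h'
  · rcases h' with rfl | h'
    · exact Or.inr h
    · exact Or.inr (h.trans h')

variable [T2Space X]

theorem IsMorseDecomposition.eq_of_omegaSet (hN : IsCompact N)
    (hD : IsMorseDecomposition φ (maxInv φ N) D) (hx : x ∈ maxInv φ N)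
    (hp : p ∈ D.idx) (hq : q ∈ D.idx) (hxp : omegaSet (fun t => φ t x) ⊆ D.M p)
    (hxq : omegaSet (fun t => φ t x) ⊆ D.M q) : p = q := by
  obtain ⟨y, hy⟩ := omegaSet_nonempty hN hx.2
  exact hD.eq_of_mem hp hq (hxp hy) (hxq hy)

theorem IsMorseDecomposition.eq_of_alphaSet (hN : IsCompact N)
    (hD : IsMorseDecomposition φ (maxInv φ N) D) (hx : x ∈ maxInv φ N)
    (hp : p ∈ D.idx) (hq : q ∈ D.idx) (hxp : alphaSet (fun t => φ t x) ⊆ D.M p)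
    (hxq : alphaSet (fun t => φ t x) ⊆ D.M q) : p = q := by
  obtain ⟨y, hy⟩ := alphaSet_nonempty hN hx.2
  exact hD.eq_of_mem hp hq (hxp hy) (hxq hy)

theorem IsMorseDecomposition.omegaSet_subset {S : Set X} (hD : IsMorseDecomposition φ S D)
    (hp : p ∈ D.idx) (hx : x ∈ D.M p) : omegaSet (fun t => φ t x) ⊆ D.M p :=
  omegaSet_subset_of_eventually (hD.isolated p hp).isCompact.isClosed
    (Eventually.of_forall fun t => (hD.isolated p hp).flow_mem hx t)

theorem IsMorseDecomposition.alphaSet_subset {S : Set X} (hD : IsMorseDecomposition φ S D)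
    (hp : p ∈ D.idx) (hx : x ∈ D.M p) : alphaSet (fun t => φ t x) ⊆ D.M p :=
  alphaSet_subset_of_eventually (hD.isolated p hp).isCompact.isClosed
    (Eventually.of_forall fun t => (hD.isolated p hp).flow_mem hx t)

/-- A point that connects `M q` to `M p` either lies in `M p` with `p = q`, or `p` is below `q`
both for the given order and for the flow-defined order. -/
theorem IsMorseDecomposition.connecting_cases (hN : IsCompact N)
    (hD : IsMorseDecomposition φ (maxInv φ N) D) (hp : p ∈ D.idx) (hq : q ∈ D.idx)
    (hx : x ∈ connecting φ (maxInv φ N) D p q) :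
    (p = q ∧ x ∈ D.M p) ∨ (D.lt p q ∧ flowStep φ (maxInv φ N) D p q) := by
  by_cases h : ∀ r ∈ D.idx, x ∉ D.M r
  · obtain ⟨p', hp', q', hq', hlt, h'⟩ := hD.connects x hx.1 h
    -- Limit sets are nonempty by compactness and Morse sets are disjoint, so the labels supplied by
    -- `connects` are the given ones.
    obtain rfl := hD.eq_of_omegaSet hN hx.1 hp hp' hx.2.1 h'.2.1
    obtain rfl := hD.eq_of_alphaSet hN hx.1 hq hq' hx.2.2 h'.2.2
    refine Or.inr ⟨hlt, hp, hq, ?_, x, hx⟩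
    rintro rfl
    exact hD.irrefl _ hp hlt
  · push Not at h
    obtain ⟨r, hr, hxr⟩ := h
    obtain rfl := hD.eq_of_omegaSet hN hx.1 hp hr hx.2.1 (hD.omegaSet_subset hr hxr)
    obtain rfl := hD.eq_of_alphaSet hN hx.1 hq hp hx.2.2 (hD.alphaSet_subset hr hxr)
    exact Or.inl ⟨rfl, hxr⟩

theorem IsMorseDecomposition.flowLE_of_connecting (hN : IsCompact N)
    (hD : IsMorseDecomposition φ (maxInv φ N) D) (hp : p ∈ D.idx) (hq : q ∈ D.idx)
    (hx : x ∈ connecting φ (maxInv φ N) D p q) : flowLE φ (maxInv φ N) D p q := by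
  rcases hD.connecting_cases hN hp hq hx with h | h
  · exact Or.inl h.1
  · exact Or.inr (Relation.TransGen.single h.2)

/-- Every connection between distinct Morse sets descends in the given order. Irreflexivity of that
order is what makes the flow-defined order antisymmetric. -/
theorem IsMorseDecomposition.lt_of_flowLT (hN : IsCompact N)
    (hD : IsMorseDecomposition φ (maxInv φ N) D) (h : flowLT φ (maxInv φ N) D p q) :
    p ∈ D.idx ∧ q ∈ D.idx ∧ D.lt p q := by
  have step : ∀ {p q}, flowStep φ (maxInv φ N) D p q → p ∈ D.idx ∧ q ∈ D.idx ∧ D.lt p q := by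
    rintro p q ⟨hp, hq, hne, x, hx⟩
    rcases hD.connecting_cases hN hp hq hx with h | h
    · exact absurd h.1 hne
    · exact ⟨hp, hq, h.1⟩
  induction h with
  | single h => exact step h
  | tail _ h ih =>
    obtain ⟨hb, hc, hlt⟩ := step h
    exact ⟨ih.1, hc, hD.trans _ ih.1 _ hb _ hc ih.2.2 hlt⟩

theorem IsMorseDecomposition.flowLE_antisymm (hN : IsCompact N)
    (hD : IsMorseDecomposition φ (maxInv φ N) D) (h : flowLE φ (maxInv φ N) D p q)
    (h' : flowLE φ (maxInv φ N) D q p) : p = q := by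
  rcases h with rfl | h
  · rfl
  · rcases h' with rfl | h'
    · rfl
    · have := hD.lt_of_flowLT hN (h.trans h')
      exact absurd this.2.2 (hD.irrefl p this.1)

end Morse

section Separation

/-- Normality applied to finitely many disjoint compact sets. Controlling `closure B`, not only `B`,
matters: a limit orbit is only known to stay in the closure. -/
theorem IsMorseDecomposition.exists_open_separating {X : Type*} [MetricSpace X] {ι : Type*}
    {φ : Flow ℝ X} {S : Set X} {D : IndexedFamily ι X} (hD : IsMorseDecomposition φ S D) {r : ι}
    (hr : r ∈ D.idx) : ∃ B : Set X, IsOpen B ∧ D.M r ⊆ B ∧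
      ∀ q ∈ D.idx, q ≠ r → D.M q ⊆ (closure B)ᶜ := by
  classical
  have hcl : IsClosed (⋃ q ∈ (D.idx.erase r : Finset ι), D.M q) :=
    (D.idx.erase r).finite_toSet.isClosed_biUnion fun q hq =>
      (hD.isolated q (Finset.mem_of_mem_erase hq)).isCompact.isClosed
  have hsub : D.M r ⊆ (⋃ q ∈ (D.idx.erase r : Finset ι), D.M q)ᶜ := by
    intro x hx hx'
    simp only [mem_iUnion, exists_prop] at hx'
    obtain ⟨q, hq, hxq⟩ := hx'
    rw [Finset.mem_erase] at hq
    exact hq.1 (hD.eq_of_mem hq.2 hr hxq hx)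
  obtain ⟨B, hB, hrB, hBc⟩ := normal_exists_closure_subset
    (hD.isolated r hr).isCompact.isClosed hcl.isOpen_compl hsub
  refine ⟨B, hB, hrB, fun q hq hne x hx hxB => hBc hxB ?_⟩
  simp only [mem_iUnion, exists_prop]
  exact ⟨q, Finset.mem_erase.2 ⟨hne, hq⟩, hx⟩

end Separation

/-! ### Ultrafilters in place of subsequences. -/

section Ultrafilters

/-- A nonnegative sequence that does not diverge along an ultrafilter is bounded on a member of it,
hence converges. Time gaps thus fall into just two cases: infinite, or a finite shift along one
orbit. -/
theorem tendsto_atTop_or_exists_tendsto_nhds (U : Ultrafilter ℕ) {s : ℕ → ℝ}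
    (hs : ∀ᶠ j in (U : Filter ℕ), 0 ≤ s j) :
    Tendsto s U atTop ∨ ∃ r, 0 ≤ r ∧ Tendsto s U (𝓝 r) := by
  by_cases h : Tendsto s U atTop
  · exact Or.inl h
  · right
    rw [tendsto_atTop] at h
    push Not at h
    obtain ⟨B, hB⟩ := h
    have hB' : ∀ᶠ j in (U : Filter ℕ), s j ∈ Icc 0 B := by
      filter_upwards [hs, hB] with j h0 h1
      exact ⟨h0, h1.le⟩
    obtain ⟨r, hr, hr'⟩ := isCompact_Icc.ultrafilter_le_nhds (U.map s)
      (le_principal_iff.2 hB')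
    exact ⟨r, hr.1, hr'⟩

theorem exists_tendsto_of_mem_compact {X : Type*} [TopologicalSpace X] {N : Set X}
    (hN : IsCompact N) (U : Ultrafilter ℕ) {s : ℕ → X}
    (hs : ∀ j, s j ∈ N) : ∃ x ∈ N, Tendsto s U (𝓝 x) :=
  hN.ultrafilter_le_nhds (U.map s)
    (le_principal_iff.2 (Eventually.of_forall hs : ∀ᶠ j in (U : Filter ℕ), s j ∈ N))

end Ultrafilters

/-- Curves in `N × ℝ` with decreasing parameter which, wherever their parameter tends to `g` along
the ultrafilter `U`, shadow orbits of the flow `φ`. -/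
structure SlowFamily {X : Type*} [TopologicalSpace X] (φ : Flow ℝ X) (N : Set X) (g : ℝ)
    (U : Ultrafilter ℕ) (v : ℕ → ℝ → X × ℝ) : Prop where
  mem : ∀ j t, (v j t).1 ∈ N
  cont : ∀ j, Continuous (v j)
  anti : ∀ j, Antitone fun t => (v j t).2
  shift : ∀ (t σ : ℕ → ℝ) (x : X) (s : ℝ), Tendsto (fun j => v j (t j)) U (𝓝 (x, g)) →
    Tendsto σ U (𝓝 s) → Tendsto (fun j => v j (t j + σ j)) U (𝓝 (φ s x, g))

/-! ### Slow curves near a frozen parameter. -/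

namespace SlowFamily

variable {X : Type*} [MetricSpace X] {ι : Type*} {φ : Flow ℝ X} {N : Set X} {g : ℝ}
  {U : Ultrafilter ℕ} {v : ℕ → ℝ → X × ℝ} {D : IndexedFamily ι X}

theorem shift_const (h : SlowFamily φ N g U v) {t : ℕ → ℝ} {x : X}
    (ht : Tendsto (fun j => v j (t j)) U (𝓝 (x, g))) (s : ℝ) :
    Tendsto (fun j => v j (t j + s)) U (𝓝 (φ s x, g)) :=
  h.shift t (fun _ => s) x s ht tendsto_const_nhds

theorem mem_maxInv (h : SlowFamily φ N g U v) (hN : IsClosed N) {t : ℕ → ℝ} {x : X}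
    (ht : Tendsto (fun j => v j (t j)) U (𝓝 (x, g))) : x ∈ maxInv φ N := by
  have key : ∀ s, φ s x ∈ N := fun s =>
    hN.mem_of_tendsto (continuous_fst.tendsto _ |>.comp (h.shift_const ht s))
      (Eventually.of_forall fun j => h.mem j _)
  exact ⟨by simpa using key 0, key⟩

theorem exists_limit (h : SlowFamily φ N g U v) (hN : IsCompact N) {t : ℕ → ℝ}
    (ht : Tendsto (fun j => (v j (t j)).2) U (𝓝 g)) :
    ∃ x, Tendsto (fun j => v j (t j)) U (𝓝 (x, g)) := by
  obtain ⟨x, -, hx⟩ := exists_tendsto_of_mem_compact hN U (s := fun j => (v j (t j)).1)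
    fun j => h.mem j _
  exact ⟨x, hx.prodMk_nhds ht⟩

theorem eq_flow_of_bounded (h : SlowFamily φ N g U v) {a b : ℕ → ℝ} {z x : X} {s : ℝ}
    (ha : Tendsto (fun j => v j (a j)) U (𝓝 (z, g)))
    (hb : Tendsto (fun j => v j (b j)) U (𝓝 (x, g)))
    (hab : Tendsto (fun j => b j - a j) U (𝓝 s)) : x = φ s z := by
  have := h.shift a _ z s ha hab
  simp only [add_sub_cancel] at this
  exact (Prod.ext_iff.1 (tendsto_nhds_unique hb this)).1

theorem exists_last_exit {u : ℝ → X} (hu : Continuous u) {B : Set X} (hB : IsOpen B) {a b : ℝ}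
    (hab : a ≤ b) (ha : u a ∉ B) : ∃ s ∈ Icc a b, u s ∉ B ∧ ∀ t ∈ Ioc s b, u t ∈ B := by
  have hc : IsCompact (Icc a b ∩ u ⁻¹' Bᶜ) :=
    isCompact_Icc.inter_right (hB.isClosed_compl.preimage hu)
  obtain ⟨s, hs, hmax⟩ := hc.exists_isGreatest ⟨a, left_mem_Icc.2 hab, ha⟩
  refine ⟨s, hs.1, hs.2, fun t ht => ?_⟩
  by_contra hBt
  exact absurd (hmax ⟨⟨hs.1.1.trans ht.1.le, ht.2⟩, hBt⟩) (not_le.2 ht.1)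

/-- Slow curves run downwards in the flow-defined order of any Morse decomposition. -/
theorem flowLE_of_tendsto_atTop (h : SlowFamily φ N g U v) (hN : IsCompact N)
    (hD : IsMorseDecomposition φ (maxInv φ N) D) {p : ι} (hp : p ∈ D.idx) {a : ℕ → ℝ} {z : X}
    (ha : Tendsto (fun j => v j (a j)) U (𝓝 (z, g)))
    (hz : omegaSet (fun t => φ t z) ⊆ D.M p) {r : ι} (hr : r ∈ D.idx) {b : ℕ → ℝ} {x : X}
    (hb : Tendsto (fun j => v j (b j)) U (𝓝 (x, g)))
    (hx : alphaSet (fun t => φ t x) ⊆ D.M r)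
    (hab : Tendsto (fun j => b j - a j) U atTop) : flowLE φ (maxInv φ N) D r p := by
  -- The order is reversed: the claim for `r` is reduced to labels strictly above `r`, and
  -- finiteness makes this well-founded.
  let R : {q // q ∈ D.idx} → {q // q ∈ D.idx} → Prop := fun q q' => D.lt q' q
  have : IsTrans _ R := ⟨fun q q' q'' h₁ h₂ =>
    hD.trans _ q''.2 _ q'.2 _ q.2 h₂ h₁⟩
  have : Std.Irrefl R := ⟨fun q => hD.irrefl _ q.2⟩
  have hwf : WellFounded R := Finite.wellFounded_of_trans_of_irrefl R
  suffices H : ∀ (r : {q // q ∈ D.idx}) (b : ℕ → ℝ) (x : X),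
      Tendsto (fun j => v j (b j)) U (𝓝 (x, g)) → alphaSet (fun t => φ t x) ⊆ D.M r →
      Tendsto (fun j => b j - a j) U atTop → flowLE φ (maxInv φ N) D r p from
    H ⟨r, hr⟩ b x hb hx hab
  clear hb hx hab hr r b x
  intro r
  induction r using hwf.induction with
  | _ r ih =>
  obtain ⟨r, hr⟩ := r
  intro b x hb hx hab
  simp only at hx ⊢
  by_cases hrp : r = p
  · exact Or.inl hrp
  have hzS := h.mem_maxInv hN.isClosed ha
  have hxS := h.mem_maxInv hN.isClosed hb
  obtain ⟨B, hB, hrB, hBsep⟩ := hD.exists_open_separating hr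
  -- `B` isolates `M r`. The orbit of `x` lies in `B` at all times up to `τ`, while `z` is outside
  -- `closure B` at time `τ'`, so the curves must enter `B` in between; their last times outside `B`
  -- are studied next.
  obtain ⟨τ, hτ⟩ := eventually_atBot.1
    (eventually_mem_of_alphaSet_subset hN hxS.2 hB (hx.trans hrB))
  obtain ⟨τ', hτ'⟩ := (eventually_mem_of_omegaSet_subset hN hzS.2 isClosed_closure.isOpen_compl
    (hz.trans (hBsep p hp (Ne.symm hrp)))).exists
  have ha' := h.shift_const ha τ'
  have hb' := h.shift_const hb τ
  have hord : ∀ᶠ j in (U : Filter ℕ), a j + τ' ≤ b j + τ := by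
    filter_upwards [hab.eventually_ge_atTop (τ' - τ)] with j hj
    linarith
  have haB : ∀ᶠ j in (U : Filter ℕ), (v j (a j + τ')).1 ∉ B := by
    filter_upwards [((continuous_fst.tendsto _).comp ha').eventually_mem
      (isClosed_closure.isOpen_compl.mem_nhds hτ')] with j hj hj'
    exact hj (subset_closure hj')
  obtain ⟨s, hs⟩ := Eventually.choice (l := (U : Filter ℕ))
    (r := fun j s => s ∈ Icc (a j + τ') (b j + τ) ∧ (v j s).1 ∉ B ∧
      ∀ t ∈ Ioc s (b j + τ), (v j t).1 ∈ B) (by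
    filter_upwards [hord, haB] with j h₁ h₂
    exact exists_last_exit (continuous_fst.comp (h.cont j)) hB h₁ h₂)
  -- Monotonicity squeezes the parameter at the exit times between two sequences tending to `g`.
  have hlam : Tendsto (fun j => (v j (s j)).2) U (𝓝 g) := by
    refine tendsto_of_tendsto_of_tendsto_of_le_of_le' ((continuous_snd.tendsto _).comp hb')
      ((continuous_snd.tendsto _).comp ha') ?_ ?_
    · filter_upwards [hs] with j hj using h.anti j hj.1.2
    · filter_upwards [hs] with j hj using h.anti j hj.1.1
  obtain ⟨y, hy⟩ := h.exists_limit hN hlam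
  have hyS := h.mem_maxInv hN.isClosed hy
  have hyB : y ∉ B := hB.isClosed_compl.mem_of_tendsto ((continuous_fst.tendsto _).comp hy)
    (hs.mono fun j hj => hj.2.1)
  -- A bounded remaining time would make `y` an earlier point on the orbit of `x`, already inside
  -- `B`.
  have hlong : Tendsto (fun j => b j + τ - s j) U atTop := by
    rcases tendsto_atTop_or_exists_tendsto_nhds U (s := fun j => b j + τ - s j)
      (hs.mono fun j hj => sub_nonneg.2 hj.1.2) with h' | ⟨σ, hσ, h'⟩
    · exact h'
    · have h'' : Tendsto (fun j => s j - b j) U (𝓝 (τ - σ)) := by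
        refine (h'.const_sub τ).congr fun j => by ring
      rw [h.eq_flow_of_bounded hb hy h''] at hyB
      exact absurd (hτ (τ - σ) (by linarith)) hyB
  have hyB' : ∀ t, 0 < t → φ t y ∈ closure B := by
    intro t ht
    refine isClosed_closure.mem_of_tendsto
      ((continuous_fst.tendsto _).comp (h.shift_const hy t)) ?_
    filter_upwards [hs, hlong.eventually_ge_atTop t] with j hj hj'
    exact subset_closure (hj.2.2 _ ⟨by linarith, by linarith⟩)
  -- The forward orbit of `y` stays in `closure B`, so its omega limit can only be in `M r`. As `y`
  -- itself is off `B`, it comes from a strictly higher label `r'`, to which the induction applies.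
  obtain ⟨q, hq, r', hr', hyc⟩ := hD.exists_labels hyS
  obtain rfl : q = r := by
    by_contra hne
    have := eventually_mem_of_omegaSet_subset hN hyS.2 isClosed_closure.isOpen_compl
      (hyc.2.1.trans (hBsep q hq hne))
    obtain ⟨t, ht, ht'⟩ := (this.and (eventually_gt_atTop 0)).exists
    exact ht (hyB' t ht')
  rcases hD.connecting_cases hN hq hr' hyc with ⟨-, hyM⟩ | ⟨hlt, hstep⟩
  · exact absurd (hrB hyM) hyB
  refine flowLE_trans (Or.inr (Relation.TransGen.single hstep))
    (ih ⟨r', hr'⟩ hlt s y hy hyc.2.2 ?_)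
  have hsa : ∀ᶠ j in (U : Filter ℕ), 0 ≤ s j - (a j + τ') :=
    hs.mono fun j hj => sub_nonneg.2 hj.1.1
  rcases tendsto_atTop_or_exists_tendsto_nhds U hsa with h' | ⟨σ, hσ, h'⟩
  · exact tendsto_atTop_add_const_right _ τ' h' |>.congr fun j => by ring
  -- A bounded gap would put `y` on the orbit of `z`, whose omega limit lies in `M p` and not in `M
  -- r`.
  · exfalso
    have hyz : y = φ (σ + τ') z := by
      rw [φ.map_add]
      exact h.eq_flow_of_bounded ha' hy h'
    have h₁ := eventually_mem_of_omegaSet_subset hN hyS.2 hB (hyc.2.1.trans hrB)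
    have h₂ := eventually_mem_of_omegaSet_subset hN hzS.2 isClosed_closure.isOpen_compl
      (hz.trans (hBsep p hp (Ne.symm hrp)))
    obtain ⟨t, ht₁, ht₂⟩ := (h₁.and
      ((tendsto_atTop_add_const_right _ (σ + τ') tendsto_id).eventually h₂)).exists
    rw [hyz, ← φ.map_add] at ht₁
    exact ht₂ (subset_closure ht₁)

end SlowFamily

namespace SlowFamily

variable {X : Type*} [MetricSpace X] {ι : Type*} {φ : Flow ℝ X} {N : Set X} {g : ℝ}
  {U : Ultrafilter ℕ} {v : ℕ → ℝ → X × ℝ} {D : IndexedFamily ι X} {p q : ι} {a b : ℕ → ℝ}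
  {x z : X}

/-- If the gap is infinite, `p` is at most the omega label of `z`, which is at most its alpha label
`q`; with `q ≤ p` all coincide, and a point connecting a Morse set to itself belongs to it. If the
gap is finite, `z` is on the orbit of `x`. -/
theorem mem_of_alphaSet_le (h : SlowFamily φ N g U v) (hN : IsCompact N)
    (hD : IsMorseDecomposition φ (maxInv φ N) D) (hp : p ∈ D.idx) (hq : q ∈ D.idx)
    (ha : Tendsto (fun j => v j (a j)) U (𝓝 (z, g)))
    (hb : Tendsto (fun j => v j (b j)) U (𝓝 (x, g)))
    (hab : ∀ᶠ j in (U : Filter ℕ), a j ≤ b j) (hx : x ∈ D.M p)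
    (hz : alphaSet (fun t => φ t z) ⊆ D.M q) (hqp : flowLE φ (maxInv φ N) D q p) :
    z ∈ D.M p := by
  rcases tendsto_atTop_or_exists_tendsto_nhds U (hab.mono fun j hj => sub_nonneg.2 hj)
    with h' | ⟨σ, -, h'⟩
  · have hzS := h.mem_maxInv hN.isClosed ha
    obtain ⟨q₁, hq₁, q₂, hq₂, hzc⟩ := hD.exists_labels hzS
    obtain rfl := hD.eq_of_alphaSet hN hzS hq₂ hq hzc.2.2 hz
    have h₁ := h.flowLE_of_tendsto_atTop hN hD hq₁ ha hzc.2.1 hp hb (hD.alphaSet_subset hp hx) h'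
    have h₂ := hD.flowLE_of_connecting hN hq₁ hq₂ hzc
    obtain rfl := hD.flowLE_antisymm hN (flowLE_trans h₁ h₂) hqp
    obtain rfl := hD.flowLE_antisymm hN h₁ h₂
    rcases hD.connecting_cases hN hq₁ hq₁ hzc with h₃ | h₃
    · exact h₃.2
    · exact absurd h₃.1 (hD.irrefl _ hq₁)
  · have := h.eq_flow_of_bounded ha hb h'
    have hz' : z = φ (-σ) x := by rw [this, ← φ.map_add]; simp
    exact hz' ▸ (hD.isolated p hp).flow_mem hx _

/-- Time-reversed counterpart of `mem_of_alphaSet_le`. -/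
theorem mem_of_le_omegaSet (h : SlowFamily φ N g U v) (hN : IsCompact N)
    (hD : IsMorseDecomposition φ (maxInv φ N) D) (hp : p ∈ D.idx) (hq : q ∈ D.idx)
    (ha : Tendsto (fun j => v j (a j)) U (𝓝 (z, g)))
    (hb : Tendsto (fun j => v j (b j)) U (𝓝 (x, g)))
    (hab : ∀ᶠ j in (U : Filter ℕ), a j ≤ b j) (hz : z ∈ D.M p)
    (hx : omegaSet (fun t => φ t x) ⊆ D.M q) (hpq : flowLE φ (maxInv φ N) D p q) :
    x ∈ D.M p := by
  rcases tendsto_atTop_or_exists_tendsto_nhds U (hab.mono fun j hj => sub_nonneg.2 hj)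
    with h' | ⟨σ, -, h'⟩
  · have hxS := h.mem_maxInv hN.isClosed hb
    obtain ⟨q₁, hq₁, q₂, hq₂, hxc⟩ := hD.exists_labels hxS
    obtain rfl := hD.eq_of_omegaSet hN hxS hq₁ hq hxc.2.1 hx
    have h₁ := h.flowLE_of_tendsto_atTop hN hD hp ha (hD.omegaSet_subset hp hz) hq₂ hb hxc.2.2 h'
    have h₂ := hD.flowLE_of_connecting hN hq₁ hq₂ hxc
    obtain rfl := hD.flowLE_antisymm hN (flowLE_trans h₂ h₁) hpq
    obtain rfl := hD.flowLE_antisymm hN h₁ h₂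
    rcases hD.connecting_cases hN hq₁ hq₁ hxc with h₃ | h₃
    · exact h₃.2
    · exact absurd h₃.1 (hD.irrefl _ hq₁)
  · rw [h.eq_flow_of_bounded ha hb h']
    exact (hD.isolated p hp).flow_mem hz _

theorem flowLE_of_mem (h : SlowFamily φ N g U v) (hN : IsCompact N)
    (hD : IsMorseDecomposition φ (maxInv φ N) D) (hp : p ∈ D.idx) (hq : q ∈ D.idx)
    (ha : Tendsto (fun j => v j (a j)) U (𝓝 (z, g)))
    (hb : Tendsto (fun j => v j (b j)) U (𝓝 (x, g)))
    (hab : ∀ᶠ j in (U : Filter ℕ), a j ≤ b j) (hz : z ∈ D.M p) (hx : x ∈ D.M q) :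
    flowLE φ (maxInv φ N) D q p := by
  rcases tendsto_atTop_or_exists_tendsto_nhds U (hab.mono fun j hj => sub_nonneg.2 hj)
    with h' | ⟨σ, -, h'⟩
  · exact h.flowLE_of_tendsto_atTop hN hD hp ha (hD.omegaSet_subset hp hz) hq hb
      (hD.alphaSet_subset hq hx) h'
  · have hx' := h.eq_flow_of_bounded ha hb h' ▸ (hD.isolated p hp).flow_mem hz σ
    exact Or.inl (hD.eq_of_mem hq hp hx hx')

end SlowFamily

/-- The set `C` consists of the limits of the curves `c n` in `N × ℝ`, whose parameters
decrease from `1` to `0` ever more slowly as `n` grows. -/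
structure IsSlowLimit {X : Type*} [TopologicalSpace X] (φ : ℝ → Flow ℝ X) (N : Set X)
    (c : ℕ → ℝ → X × ℝ) (C : Set (X × ℝ)) : Prop where
  closed : IsClosed C
  exists_seq : ∀ z ∈ C, ∃ t : ℕ → ℝ, Tendsto (fun n => c n (t n)) atTop (𝓝 z)
  mem_of_tendsto : ∀ (U : Ultrafilter ℕ) (n : ℕ → ℕ), Tendsto n U atTop → ∀ (t : ℕ → ℝ) (z : X × ℝ),
    Tendsto (fun j => c (n j) (t j)) U (𝓝 z) → z ∈ C
  slow : ∀ g ∈ Icc (0 : ℝ) 1, ∀ (U : Ultrafilter ℕ) (n : ℕ → ℕ), Tendsto n U atTop →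
    SlowFamily (φ g) N g U fun j => c (n j)
  hits : ∀ g ∈ Icc (0 : ℝ) 1, ∃ t : ℕ → ℝ, Tendsto (fun n => (c n (t n)).2) atTop (𝓝 g)

theorem exists_greatest_of_total {α : Type*} {R : α → α → Prop}
    (htrans : ∀ a b c, R a b → R b c → R a c) {s : Set α} (hs : s.Finite) (hne : s.Nonempty)
    (htot : ∀ a ∈ s, ∀ b ∈ s, R a b ∨ R b a) : ∃ m ∈ s, ∀ a ∈ s, R a m := by
  induction s, hs using Set.Finite.induction_on with
  | empty => exact absurd hne not_nonempty_empty
  | @insert a s _ _ ih =>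
    have ha : R a a := by simpa using htot a (mem_insert a s) a (mem_insert a s)
    rcases s.eq_empty_or_nonempty with rfl | hs
    · exact ⟨a, by simp, by simpa using ha⟩
    · obtain ⟨m, hm, hmax⟩ := ih hs fun x hx y hy =>
        htot x (mem_insert_of_mem a hx) y (mem_insert_of_mem a hy)
      rcases htot a (mem_insert a s) m (mem_insert_of_mem a hm) with h | h
      · refine ⟨m, mem_insert_of_mem a hm, ?_⟩
        rintro x (rfl | hx)
        · exact h
        · exact hmax x hx
      · refine ⟨a, mem_insert a s, ?_⟩
        rintro x (rfl | hx)
        · exact ha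
        · exact htrans _ _ _ (hmax x hx) h

/-! ### Slices of the limit set. -/

namespace IsSlowLimit

variable {X : Type*} [MetricSpace X] {ι : Type*} {φ : ℝ → Flow ℝ X} {N : Set X}
  {c : ℕ → ℝ → X × ℝ} {C : Set (X × ℝ)} {D : ℝ → IndexedFamily ι X} {g : ℝ} {p q : ι} {x : X}

theorem slow_hyperfilter (h : IsSlowLimit φ N c C) (hg : g ∈ Icc (0 : ℝ) 1) :
    SlowFamily (φ g) N g (hyperfilter ℕ) c :=
  h.slow g hg (hyperfilter ℕ) id (tendsto_id.mono_left Nat.hyperfilter_le_atTop)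

theorem flow_mem (h : IsSlowLimit φ N c C) (hg : g ∈ Icc (0 : ℝ) 1) (hx : (x, g) ∈ C) (t : ℝ) :
    (φ g t x, g) ∈ C := by
  obtain ⟨s, hs⟩ := h.exists_seq _ hx
  exact h.mem_of_tendsto (hyperfilter ℕ) id (tendsto_id.mono_left Nat.hyperfilter_le_atTop) _ _
    ((h.slow_hyperfilter hg).shift_const (hs.mono_left Nat.hyperfilter_le_atTop) t)

theorem mem_slice (h : IsSlowLimit φ N c C) (hN : IsCompact N) (hg : g ∈ Icc (0 : ℝ) 1)
    (hx : (x, g) ∈ C) : x ∈ maxInv (φ g) N := by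
  obtain ⟨s, hs⟩ := h.exists_seq _ hx
  exact (h.slow_hyperfilter hg).mem_maxInv hN.isClosed (hs.mono_left Nat.hyperfilter_le_atTop)

theorem exists_mem (h : IsSlowLimit φ N c C) (hN : IsCompact N) (hg : g ∈ Icc (0 : ℝ) 1) :
    ∃ x, (x, g) ∈ C := by
  obtain ⟨t, ht⟩ := h.hits g hg
  obtain ⟨x, hx⟩ := (h.slow_hyperfilter hg).exists_limit hN
    (ht.mono_left Nat.hyperfilter_le_atTop)
  exact ⟨x, h.mem_of_tendsto (hyperfilter ℕ) id
    (tendsto_id.mono_left Nat.hyperfilter_le_atTop) _ _ hx⟩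

theorem isClosed_slice (h : IsSlowLimit φ N c C) (g : ℝ) : IsClosed {x | (x, g) ∈ C} :=
  h.closed.preimage (by fun_prop : Continuous fun x : X => (x, g))

theorem exists_labels (h : IsSlowLimit φ N c C) (hN : IsCompact N) (hg : g ∈ Icc (0 : ℝ) 1)
    (hD : IsMorseDecomposition (φ g) (maxInv (φ g) N) (D g)) (hx : (x, g) ∈ C) :
    ∃ p ∈ sliceLabels D C g, ∃ q ∈ sliceLabels D C g,
      x ∈ connecting (φ g) (maxInv (φ g) N) (D g) p q := by
  have hxS := h.mem_slice hN hg hx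
  obtain ⟨p, hp, q, hq, hpq⟩ := hD.exists_labels hxS
  refine ⟨p, ⟨hp, ?_⟩, q, ⟨hq, ?_⟩, hpq⟩
  · obtain ⟨y, hy⟩ := omegaSet_nonempty hN hxS.2
    exact ⟨y, hpq.2.1 hy, omegaSet_subset_of_eventually (h.isClosed_slice g)
      (Eventually.of_forall fun t => h.flow_mem hg hx t) hy⟩
  · obtain ⟨y, hy⟩ := alphaSet_nonempty hN hxS.2
    exact ⟨y, hpq.2.2 hy, alphaSet_subset_of_eventually (h.isClosed_slice g)
      (Eventually.of_forall fun t => h.flow_mem hg hx t) hy⟩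

theorem sliceLabels_nonempty (h : IsSlowLimit φ N c C) (hN : IsCompact N)
    (hg : g ∈ Icc (0 : ℝ) 1) (hD : IsMorseDecomposition (φ g) (maxInv (φ g) N) (D g)) :
    (sliceLabels D C g).Nonempty := by
  obtain ⟨x, hx⟩ := h.exists_mem hN hg
  obtain ⟨p, hp, -⟩ := h.exists_labels hN hg hD hx
  exact ⟨p, hp⟩

/-- The ultrafilter decides which of two approximating time sequences comes first; the later point
then has the lower label. -/
theorem flowLE_total (h : IsSlowLimit φ N c C) (hN : IsCompact N) (hg : g ∈ Icc (0 : ℝ) 1)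
    (hD : IsMorseDecomposition (φ g) (maxInv (φ g) N) (D g)) (hp : p ∈ sliceLabels D C g)
    (hq : q ∈ sliceLabels D C g) : flowLE (φ g) (maxInv (φ g) N) (D g) p q ∨
      flowLE (φ g) (maxInv (φ g) N) (D g) q p := by
  obtain ⟨hp, x, hx, hxC⟩ := hp
  obtain ⟨hq, y, hy, hyC⟩ := hq
  obtain ⟨t, ht⟩ := h.exists_seq _ hxC
  obtain ⟨s, hs⟩ := h.exists_seq _ hyC
  have ht := ht.mono_left Nat.hyperfilter_le_atTop
  have hs := hs.mono_left Nat.hyperfilter_le_atTop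
  have hv := h.slow_hyperfilter hg
  rcases (hyperfilter ℕ).em (fun j => t j ≤ s j) with h' | h'
  · exact Or.inr (hv.flowLE_of_mem hN hD hp hq ht hs h' hx hy)
  · exact Or.inl (hv.flowLE_of_mem hN hD hq hp hs ht (h'.mono fun j hj => (not_le.1 hj).le) hy hx)

theorem exists_isFlowSup (h : IsSlowLimit φ N c C) (hN : IsCompact N) (hg : g ∈ Icc (0 : ℝ) 1)
    (hD : IsMorseDecomposition (φ g) (maxInv (φ g) N) (D g)) :
    ∃ p, IsFlowSup (φ g) (maxInv (φ g) N) (D g) (sliceLabels D C g) p :=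
  exists_greatest_of_total (R := flowLE (φ g) (maxInv (φ g) N) (D g))
    (fun _ _ _ h₁ h₂ => flowLE_trans h₁ h₂) ((D g).idx.finite_toSet.subset fun _ hp => hp.1)
    (h.sliceLabels_nonempty hN hg hD) fun _ hp _ hq => h.flowLE_total hN hg hD hp hq

theorem exists_isFlowInf (h : IsSlowLimit φ N c C) (hN : IsCompact N) (hg : g ∈ Icc (0 : ℝ) 1)
    (hD : IsMorseDecomposition (φ g) (maxInv (φ g) N) (D g)) :
    ∃ p, IsFlowInf (φ g) (maxInv (φ g) N) (D g) (sliceLabels D C g) p :=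
  exists_greatest_of_total (R := fun p q => flowLE (φ g) (maxInv (φ g) N) (D g) q p)
    (fun _ _ _ h₁ h₂ => flowLE_trans h₂ h₁) ((D g).idx.finite_toSet.subset fun _ hp => hp.1)
    (h.sliceLabels_nonempty hN hg hD) fun _ hp _ hq => h.flowLE_total hN hg hD hq hp

/-- Points of `C` at parameters `s j → g` outside an open set `V` are approximated, together with
a given point `(w, g)` of `C`, along one sequence of curves. -/
theorem exists_common_approx (h : IsSlowLimit φ N c C) (hN : IsCompact N)
    {V : Set X} (hV : IsOpen V) {w : X} (hw : (w, g) ∈ C) {x : ℕ → X} {s : ℕ → ℝ}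
    (hs : Tendsto s atTop (𝓝 g)) (hxC : ∀ j, (x j, s j) ∈ C) (hxV : ∀ j, x j ∉ V)
    (hxN : ∀ j, x j ∈ N) :
    ∃ (n : ℕ → ℕ) (t t' : ℕ → ℝ) (y : X), Tendsto n (hyperfilter ℕ : Filter ℕ) atTop ∧ y ∉ V ∧
      Tendsto (fun j => c (n j) (t j)) (hyperfilter ℕ : Filter ℕ) (𝓝 (y, g)) ∧
      Tendsto (fun j => c (n j) (t' j)) (hyperfilter ℕ : Filter ℕ) (𝓝 (w, g)) ∧
      (∀ j, g < s j → (c (n j) (t' j)).2 < (c (n j) (t j)).2) ∧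
      (∀ j, s j < g → (c (n j) (t j)).2 < (c (n j) (t' j)).2) := by
  obtain ⟨t', ht'⟩ := h.exists_seq _ hw
  choose τ hτ using fun j => h.exists_seq _ (hxC j)
  have ht₂ := (continuous_snd.tendsto _).comp ht'
  -- Diagonal choice. The strict inequality between `s j` and `g` passes to the curves for large
  -- `n`; monotonicity of the parameter later turns it into an ordering of the times.
  have key : ∀ j : ℕ, ∃ n : ℕ, j ≤ n ∧ dist (c n (τ j n)) (x j, s j) < 1 / ((j : ℝ) + 1) ∧
      (g < s j → (c n (t' n)).2 < (c n (τ j n)).2) ∧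
      (s j < g → (c n (τ j n)).2 < (c n (t' n)).2) := by
    intro j
    have hτ₂ := (continuous_snd.tendsto _).comp (hτ j)
    have h₁ := (hτ j).eventually (Metric.ball_mem_nhds (x j, s j) (by positivity :
      (0 : ℝ) < 1 / ((j : ℝ) + 1)))
    have h₂ : ∀ᶠ n in atTop, g < s j → (c n (t' n)).2 < (c n (τ j n)).2 := by
      by_cases hlt : g < s j
      · exact (ht₂.eventually_lt hτ₂ hlt).mono fun n hn _ => hn
      · exact Eventually.of_forall fun n hn => absurd hn hlt
    have h₃ : ∀ᶠ n in atTop, s j < g → (c n (τ j n)).2 < (c n (t' n)).2 := by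
      by_cases hlt : s j < g
      · exact (hτ₂.eventually_lt ht₂ hlt).mono fun n hn _ => hn
      · exact Eventually.of_forall fun n hn => absurd hn hlt
    exact ((eventually_ge_atTop j).and (h₁.and (h₂.and h₃))).exists
  choose n hn hdist hgt hlt using key
  have hnT : Tendsto n (hyperfilter ℕ : Filter ℕ) atTop :=
    (tendsto_atTop_mono hn tendsto_id).mono_left Nat.hyperfilter_le_atTop
  obtain ⟨y, -, hy⟩ := exists_tendsto_of_mem_compact hN (hyperfilter ℕ) hxN
  refine ⟨n, fun j => τ j (n j), fun j => t' (n j), y, hnT,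
    hV.isClosed_compl.mem_of_tendsto hy (Eventually.of_forall hxV), ?_, ht'.comp hnT, hgt, hlt⟩
  have hlim := hy.prodMk_nhds (hs.mono_left Nat.hyperfilter_le_atTop)
  refine tendsto_iff_dist_tendsto_zero.2 (squeeze_zero (fun _ => dist_nonneg)
    (fun j => dist_triangle _ (x j, s j) _) ?_)
  have h₀ : Tendsto (fun j => dist (c (n j) (τ j (n j))) (x j, s j))
      (hyperfilter ℕ : Filter ℕ) (𝓝 0) :=
    squeeze_zero (fun _ => dist_nonneg) (fun j => (hdist j).le)
      (tendsto_one_div_add_atTop_nhds_zero_nat.mono_left Nat.hyperfilter_le_atTop)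
  simpa using h₀.add (tendsto_iff_dist_tendsto_zero.1 hlim)

theorem fst_mem (h : IsSlowLimit φ N c C) (hN : IsClosed N) {z : X × ℝ} (hz : z ∈ C) :
    z.1 ∈ N := by
  obtain ⟨t, ht⟩ := h.exists_seq _ hz
  have hv := h.slow_hyperfilter (g := 0) (by simp)
  exact hN.mem_of_tendsto ((continuous_fst.tendsto _).comp ht)
    (Eventually.of_forall fun n => hv.mem n _)

/-- Otherwise points outside `V` at parameters above `g` accumulate at some `y`. The curves visit
them before a point of `M p`, and the alpha label of `y` is at most the greatest label `p`, so
`mem_of_alphaSet_le` puts `y` in `M p`. -/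
theorem eventually_right (h : IsSlowLimit φ N c C) (hN : IsCompact N) (hg : g ∈ Icc (0 : ℝ) 1)
    (hD : IsMorseDecomposition (φ g) (maxInv (φ g) N) (D g))
    (hp : IsFlowSup (φ g) (maxInv (φ g) N) (D g) (sliceLabels D C g) p) {V : Set X}
    (hV : IsOpen V) (hpV : (D g).M p ⊆ V) : ∀ᶠ s in 𝓝[>] g, ∀ x, (x, s) ∈ C → x ∈ V := by
  by_contra hcon
  obtain ⟨s, hs, hs'⟩ := exists_seq_forall_of_frequently
    ((not_eventually.1 hcon).and_eventually self_mem_nhdsWithin)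
  have hs₁ := fun j => (hs' j).1
  push Not at hs₁
  choose x hxC hxV using hs₁
  obtain ⟨⟨hp, w, hw, hwC⟩, hmax⟩ := hp
  obtain ⟨n, t, t', y, hn, hyV, hy, hw', hlt, -⟩ := h.exists_common_approx hN hV hwC
    (hs.mono_right nhdsWithin_le_nhds) hxC hxV fun j => h.fst_mem hN.isClosed (hxC j)
  have hyC := h.mem_of_tendsto _ n hn t _ hy
  have hv := h.slow g hg _ n hn
  obtain ⟨_, _, q, hq, hyq⟩ := h.exists_labels hN hg hD hyC
  refine hyV (hpV (hv.mem_of_alphaSet_le hN hD hp hq.1 hy hw' (Eventually.of_forall fun j => ?_)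
    hw hyq.2.2 (hmax q hq)))
  exact (lt_of_not_ge fun hle => absurd (hlt j (hs' j).2) (not_lt.2 (hv.anti j hle))).le

/-- Same argument after time reversal: lower parameters are visited later, and the omega label is at
least the least label. -/
theorem eventually_left (h : IsSlowLimit φ N c C) (hN : IsCompact N) (hg : g ∈ Icc (0 : ℝ) 1)
    (hD : IsMorseDecomposition (φ g) (maxInv (φ g) N) (D g))
    (hp : IsFlowInf (φ g) (maxInv (φ g) N) (D g) (sliceLabels D C g) p) {V : Set X}
    (hV : IsOpen V) (hpV : (D g).M p ⊆ V) : ∀ᶠ s in 𝓝[<] g, ∀ x, (x, s) ∈ C → x ∈ V := by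
  by_contra hcon
  obtain ⟨s, hs, hs'⟩ := exists_seq_forall_of_frequently
    ((not_eventually.1 hcon).and_eventually self_mem_nhdsWithin)
  have hs₁ := fun j => (hs' j).1
  push Not at hs₁
  choose x hxC hxV using hs₁
  obtain ⟨⟨hp, w, hw, hwC⟩, hmin⟩ := hp
  obtain ⟨n, t, t', y, hn, hyV, hy, hw', -, hlt⟩ := h.exists_common_approx hN hV hwC
    (hs.mono_right nhdsWithin_le_nhds) hxC hxV fun j => h.fst_mem hN.isClosed (hxC j)
  have hyC := h.mem_of_tendsto _ n hn t _ hy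
  have hv := h.slow g hg _ n hn
  obtain ⟨q, hq, _, _, hyq⟩ := h.exists_labels hN hg hD hyC
  refine hyV (hpV (hv.mem_of_le_omegaSet hN hD hp hq.1 hw' hy (Eventually.of_forall fun j => ?_)
    hw hyq.2.1 (hmin q hq)))
  exact (lt_of_not_ge fun hle => absurd (hlt j (hs' j).2) (not_lt.2 (hv.anti j hle))).le

end IsSlowLimit

/-! ### Shadowing of the frozen flow. -/

section Shadowing

variable {E : Type*} [NormedAddCommGroup E] [NormedSpace ℝ E] {f : E × ℝ → E} {κ : NNReal}
  {Λ : Set ℝ} {g η T : ℝ}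

theorem dist_le_of_drift_forward (hf : LipschitzOnWith κ f (univ ×ˢ Λ)) (hg : g ∈ Λ)
    {u y : ℝ → E} {μ : ℝ → ℝ} (hu : ∀ t, HasDerivAt u (f (u t, μ t)) t) (hμ : ∀ t, μ t ∈ Λ)
    (hy : ∀ t, HasDerivAt y (f (y t, g)) t) (h0 : u 0 = y 0) (hη : 0 ≤ η)
    (hμη : ∀ t ∈ Icc 0 T, |μ t - g| ≤ η) :
    ∀ t ∈ Icc 0 T, dist (u t) (y t) ≤ η * Real.exp ((κ + 1) * T) := by
  -- The constant is raised to `κ + 1` to be nonzero, so that the quotient form of the Gronwall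
  -- bound applies even when `κ = 0`.
  have hL : LipschitzWith (κ + 1) fun x => f (x, g) := by
    refine (LipschitzWith.of_dist_le_mul fun x y => ?_ : LipschitzWith κ fun x => f (x, g)).weaken
      (by simp)
    simpa [Prod.dist_eq] using hf.dist_le_mul (x, g) ⟨mem_univ _, hg⟩ (y, g) ⟨mem_univ _, hg⟩
  intro t ht
  have := dist_le_of_approx_trajectories_ODE (v := fun _ x => f (x, g)) (K := κ + 1) (f := u)
    (g := y) (a := 0) (b := T) (εf := κ * η) (εg := 0) (δ := 0) (fun _ => hL)
    (fun t _ => (hu t).continuousAt.continuousWithinAt) (fun t _ => (hu t).hasDerivWithinAt)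
    (fun t ht => by
      refine (hf.dist_le_mul (u t, μ t) ⟨mem_univ _, hμ t⟩ (u t, g) ⟨mem_univ _, hg⟩).trans ?_
      gcongr
      simpa [Prod.dist_eq, Real.dist_eq] using hμη t ⟨ht.1, ht.2.le⟩)
    (fun t _ => (hy t).continuousAt.continuousWithinAt) (fun t _ => (hy t).hasDerivWithinAt)
    (fun t _ => by simp) (by simp [h0]) t ht
  have hK : (0 : ℝ) < κ + 1 := by positivity
  rw [gronwallBound_of_K_ne_0 (by push_cast; exact hK.ne')] at this
  push_cast at this
  simp only [zero_mul, zero_add, add_zero, sub_zero] at this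
  have h₁ : (κ : ℝ) * η / (κ + 1) ≤ η := by
    rw [div_le_iff₀ hK]
    nlinarith [κ.coe_nonneg]
  have h₂ : 1 ≤ Real.exp ((κ + 1) * t) := Real.one_le_exp (by have := ht.1; positivity)
  calc dist (u t) (y t) ≤ _ := this
    _ ≤ η * (Real.exp ((κ + 1) * t) - 1) := mul_le_mul_of_nonneg_right h₁ (by linarith)
    _ ≤ η * Real.exp ((κ + 1) * t) := by gcongr; linarith
    _ ≤ η * Real.exp ((κ + 1) * T) := by gcongr; exact ht.2

theorem dist_le_of_drift (hf : LipschitzOnWith κ f (univ ×ˢ Λ)) (hg : g ∈ Λ)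
    {u y : ℝ → E} {μ : ℝ → ℝ} (hu : ∀ t, HasDerivAt u (f (u t, μ t)) t) (hμ : ∀ t, μ t ∈ Λ)
    (hy : ∀ t, HasDerivAt y (f (y t, g)) t) (h0 : u 0 = y 0) (hη : 0 ≤ η)
    (hμη : ∀ t, |t| ≤ T → |μ t - g| ≤ η) {t : ℝ} (ht : |t| ≤ T) :
    dist (u t) (y t) ≤ η * Real.exp ((κ + 1) * T) := by
  rcases le_total 0 t with h | h
  · exact dist_le_of_drift_forward hf hg hu hμ hy h0 hη
      (fun s hs => hμη s (by rw [abs_of_nonneg hs.1]; exact hs.2)) t ⟨h, (le_abs_self t).trans ht⟩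
  · have hneg : ∀ t : ℝ, HasDerivAt (fun s : ℝ => -s) (-1) t := fun t => hasDerivAt_neg t
    have := dist_le_of_drift_forward (f := fun z => -f z) (u := fun s => u (-s))
      (y := fun s => y (-s)) (μ := fun s => μ (-s)) (κ := κ) (T := T)
      hf.neg hg
      (fun s => by simpa using! (hu (-s)).scomp s (hneg s)) (fun s => hμ _)
      (fun s => by simpa using! (hy (-s)).scomp s (hneg s)) (by simpa using h0) hη
      (fun s hs => hμη (-s) (by rw [abs_neg, abs_of_nonneg hs.1]; exact hs.2)) (-t)
      ⟨by linarith, (neg_le_abs t).trans ht⟩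
    simpa using this

/-- Each curve is compared with the frozen orbit from its own initial point; joint continuity of the
flow does the rest. -/
theorem tendsto_flow_of_drift (hf : LipschitzOnWith κ f (univ ×ˢ Λ)) (hg : g ∈ Λ)
    {φ : Flow ℝ E} (hφ : ∀ (x : E) (t : ℝ), HasDerivAt (fun τ => φ τ x) (f (φ t x, g)) t)
    {l : Filter ℕ} {u : ℕ → ℝ → E} {μ : ℕ → ℝ → ℝ}
    (hu : ∀ j t, HasDerivAt (u j) (f (u j t, μ j t)) t) (hμ : ∀ j t, μ j t ∈ Λ)
    (hμg : ∀ T η : ℝ, 0 < η → ∀ᶠ j in l, ∀ t, |t| ≤ T → |μ j t - g| ≤ η)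
    {x : E} (hx : Tendsto (fun j => u j 0) l (𝓝 x)) {σ : ℕ → ℝ} {s : ℝ}
    (hσ : Tendsto σ l (𝓝 s)) : Tendsto (fun j => u j (σ j)) l (𝓝 (φ s x)) := by
  have h₁ : Tendsto (fun j => φ (σ j) (u j 0)) l (𝓝 (φ s x)) :=
    (φ.cont'.tendsto (s, x)).comp (hσ.prodMk_nhds hx)
  refine (tendsto_iff_of_dist ?_).1 h₁
  rw [Metric.tendsto_nhds]
  intro r hr
  set A := Real.exp ((κ + 1) * (|s| + 1)) with hA
  have hApos : 0 < A := Real.exp_pos _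
  have hσ' : ∀ᶠ j in l, |σ j| ≤ |s| + 1 :=
    (hσ.abs.eventually_lt_const (lt_add_one |s|)).mono fun j hj => hj.le
  filter_upwards [hσ', hμg (|s| + 1) (r / (2 * A)) (by positivity)] with j hj hj'
  have := dist_le_of_drift (y := fun t => φ t (u j 0)) hf hg (hu j) (hμ j) (hφ _) (by simp)
    (by positivity) hj' hj
  rw [Real.dist_0_eq_abs, abs_of_nonneg dist_nonneg, dist_comm]
  calc _ ≤ _ := this
    _ = r / 2 := by rw [← hA]; field_simp
    _ < r := by linarith

end Shadowing

/-! ### Uniqueness for the drift equation, and approximation of limit points. -/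

section Drift

/-- Uniqueness for a linear equation with bounded coefficient. It makes the parameter values `0` and
`1` impossible to cross. -/
theorem eq_zero_of_hasDerivAt_mul {w a : ℝ → ℝ} {K : ℝ} (ha : ∀ t, |a t| ≤ K)
    (hw : ∀ t, HasDerivAt w (a t * w t) t) {t₀ : ℝ} (h0 : w t₀ = 0) (t : ℝ) : w t = 0 := by
  have hK : 0 ≤ K := (abs_nonneg _).trans (ha 0)
  have := ODE_solution_unique_univ (v := fun t x => a t * x) (s := fun _ => univ) (K := ⟨K, hK⟩)
    (f := w) (g := fun _ => 0) (t₀ := t₀)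
    (fun t => (LipschitzWith.of_dist_le_mul fun x y => by
      rw [Real.dist_eq, Real.dist_eq, ← mul_sub, abs_mul]
      exact mul_le_mul_of_nonneg_right (ha t) (abs_nonneg _)).lipschitzOnWith)
    (fun t => ⟨hw t, mem_univ _⟩) (fun t => ⟨by simpa using hasDerivAt_const t (0 : ℝ), mem_univ _⟩)
    h0
  exact congrFun this t

theorem exists_le_mem_of_alphaSet {Y : Type*} [TopologicalSpace Y] {c : ℝ → Y} {w : Y}
    (hw : w ∈ alphaSet c) {V : Set Y} (hV : V ∈ 𝓝 w) (T : ℝ) : ∃ t ≤ T, c t ∈ V := by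
  obtain ⟨t, ⟨_, -, ht⟩, htT⟩ := (((mem_omegaLimit_iff_frequently _ _ _ _).1 hw V hV).and_eventually
    (eventually_le_atBot T)).exists
  exact ⟨t, htT, ht⟩

theorem exists_ge_mem_of_omegaSet {Y : Type*} [TopologicalSpace Y] {c : ℝ → Y} {w : Y}
    (hw : w ∈ omegaSet c) {V : Set Y} (hV : V ∈ 𝓝 w) (T : ℝ) : ∃ t ≥ T, c t ∈ V := by
  obtain ⟨t, ⟨_, -, ht⟩, htT⟩ := (((mem_omegaLimit_iff_frequently _ _ _ _).1 hw V hV).and_eventually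
    (eventually_ge_atTop T)).exists
  exact ⟨t, htT, ht⟩

end Drift

/-! ### The parameter along a connecting orbit. -/

namespace IsConnectingOrbit

variable {d : ℕ} {α β : ℝ} {f : Phase d × ℝ → Phase d} {N : Set (Phase d)} {ε : ℝ}
  {R B : Set (Phase d)} {c : ℝ → Phase d × ℝ}

theorem mem_compact (h : IsConnectingOrbit (Ioo α β) f N ε R B c) (t : ℝ) :
    c t ∈ N ×ˢ Icc α β :=
  ⟨(h.mem t).1, Ioo_subset_Icc_self (h.mem t).2⟩

theorem exists_alpha (h : IsConnectingOrbit (Ioo α β) f N ε R B c) (hN : IsCompact N) :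
    ∃ x ∈ R, (x, (1 : ℝ)) ∈ alphaSet c := by
  obtain ⟨⟨x, s⟩, hw⟩ := alphaSet_nonempty (hN.prod isCompact_Icc) h.mem_compact
  obtain ⟨hx, hs⟩ := h.alpha hw
  obtain rfl : s = 1 := hs
  exact ⟨x, hx, hw⟩

theorem exists_omega (h : IsConnectingOrbit (Ioo α β) f N ε R B c) (hN : IsCompact N) :
    ∃ x ∈ B, (x, (0 : ℝ)) ∈ omegaSet c := by
  obtain ⟨⟨x, s⟩, hw⟩ := omegaSet_nonempty (hN.prod isCompact_Icc) h.mem_compact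
  obtain ⟨hx, hs⟩ := h.omega hw
  obtain rfl : s = 0 := hs
  exact ⟨x, hx, hw⟩

theorem hasDerivAt_fst (h : IsConnectingOrbit (Ioo α β) f N ε R B c) (t : ℝ) :
    HasDerivAt (fun t => (c t).1) (f (c t)) t := (h.solution t).fst

theorem hasDerivAt_snd (h : IsConnectingOrbit (Ioo α β) f N ε R B c) (t : ℝ) :
    HasDerivAt (fun t => (c t).2) (ε * (c t).2 * ((c t).2 - 1)) t := (h.solution t).snd

theorem continuous (h : IsConnectingOrbit (Ioo α β) f N ε R B c) : Continuous c :=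
  continuous_iff_continuousAt.2 fun t => (h.solution t).continuousAt

theorem continuous_snd (h : IsConnectingOrbit (Ioo α β) f N ε R B c) :
    Continuous fun t => (c t).2 := _root_.continuous_snd.comp h.continuous

theorem exists_snd_gt (h : IsConnectingOrbit (Ioo α β) f N ε R B c) (hN : IsCompact N) {s : ℝ}
    (hs : s < 1) : ∃ t, s < (c t).2 := by
  obtain ⟨x, -, hx⟩ := h.exists_alpha hN
  obtain ⟨t, -, ht⟩ := exists_le_mem_of_alphaSet hx
    ((isOpen_lt continuous_const _root_.continuous_snd).mem_nhds
      (show s < ((x, (1 : ℝ)) : Phase d × ℝ).2 from hs)) 0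
  exact ⟨t, ht⟩

theorem exists_snd_lt (h : IsConnectingOrbit (Ioo α β) f N ε R B c) (hN : IsCompact N) {s : ℝ}
    (hs : 0 < s) : ∃ t, (c t).2 < s := by
  obtain ⟨x, -, hx⟩ := h.exists_omega hN
  obtain ⟨t, -, ht⟩ := exists_ge_mem_of_omegaSet hx
    ((isOpen_lt _root_.continuous_snd continuous_const).mem_nhds
      (show ((x, (0 : ℝ)) : Phase d × ℝ).2 < s from hs)) 0
  exact ⟨t, ht⟩

theorem abs_snd_le (h : IsConnectingOrbit (Ioo α β) f N ε R B c) (t : ℝ) :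
    |(c t).2| ≤ |α| + |β| := by
  have := (h.mem t).2
  rw [abs_le]
  constructor
  · linarith [neg_abs_le α, abs_nonneg β, this.1]
  · linarith [le_abs_self β, abs_nonneg α, this.2]

/-- The parameter comes close to `1`; were it also nonpositive somewhere, it would vanish at some
time and hence identically. -/
theorem snd_pos (h : IsConnectingOrbit (Ioo α β) f N ε R B c) (hN : IsCompact N) (t : ℝ) :
    0 < (c t).2 := by
  by_contra hcon
  obtain ⟨t₁, ht₁⟩ := h.exists_snd_gt hN zero_lt_one
  obtain ⟨t₀, ht₀⟩ := mem_range_of_exists_le_of_exists_ge h.continuous_snd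
    ⟨t, not_lt.1 hcon⟩ ⟨t₁, ht₁.le⟩
  have := eq_zero_of_hasDerivAt_mul (w := fun t => (c t).2) (a := fun t => ε * ((c t).2 - 1))
    (K := |ε| * (|α| + |β| + 1)) (fun t => by
      rw [abs_mul]
      gcongr
      exact (abs_sub _ _).trans (by simpa using h.abs_snd_le t))
    (fun t => (h.hasDerivAt_snd t).congr_deriv (by ring)) ht₀ t₁
  linarith

theorem snd_lt_one (h : IsConnectingOrbit (Ioo α β) f N ε R B c) (hN : IsCompact N) (t : ℝ) :
    (c t).2 < 1 := by
  by_contra hcon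
  obtain ⟨t₁, ht₁⟩ := h.exists_snd_lt hN zero_lt_one
  obtain ⟨t₀, ht₀⟩ := mem_range_of_exists_le_of_exists_ge h.continuous_snd
    ⟨t₁, ht₁.le⟩ ⟨t, not_lt.1 hcon⟩
  have := eq_zero_of_hasDerivAt_mul (w := fun t => (c t).2 - 1) (a := fun t => ε * (c t).2)
    (K := |ε| * (|α| + |β|)) (fun t => by
      rw [abs_mul]
      gcongr
      exact h.abs_snd_le t)
    (fun t => (h.hasDerivAt_snd t).sub_const 1) (t₀ := t₀) (by simp [ht₀]) t₁
  linarith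

theorem antitone_snd (h : IsConnectingOrbit (Ioo α β) f N ε R B c) (hN : IsCompact N)
    (hε : 0 < ε) : Antitone fun t => (c t).2 := by
  refine antitone_of_deriv_nonpos (fun t => (h.hasDerivAt_snd t).differentiableAt) fun t => ?_
  rw [(h.hasDerivAt_snd t).deriv]
  exact mul_nonpos_of_nonneg_of_nonpos (mul_nonneg hε.le (h.snd_pos hN t).le)
    (by linarith [h.snd_lt_one hN t])

theorem abs_snd_sub_le (h : IsConnectingOrbit (Ioo α β) f N ε R B c) (hN : IsCompact N)
    (hε : 0 < ε) (s t : ℝ) : |(c t).2 - (c s).2| ≤ ε * |t - s| := by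
  refine convex_univ.norm_image_sub_le_of_norm_hasDerivWithin_le
    (fun t _ => (h.hasDerivAt_snd t).hasDerivWithinAt) (fun t _ => ?_) (mem_univ s) (mem_univ t)
  have h₀ := h.snd_pos hN t
  have h₁ := h.snd_lt_one hN t
  rw [Real.norm_eq_abs, abs_le]
  constructor <;> nlinarith [mul_pos hε h₀, mul_pos (mul_pos hε h₀) (sub_pos.2 h₁),
    mul_pos hε (sub_pos.2 h₁)]

/-- The range of the parameter is connected and its closure contains `0` and `1`. -/
theorem exists_snd_near (h : IsConnectingOrbit (Ioo α β) f N ε R B c) (hN : IsCompact N) {g η : ℝ}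
    (hg : g ∈ Icc (0 : ℝ) 1) (hη : 0 < η) : ∃ t, dist (c t).2 g < η := by
  have hpre : IsPreconnected (closure (range fun t => (c t).2)) :=
    (isPreconnected_range h.continuous_snd).closure
  have h0 : (0 : ℝ) ∈ closure (range fun t => (c t).2) := by
    refine Metric.mem_closure_iff.2 fun r hr => ?_
    obtain ⟨t, ht⟩ := h.exists_snd_lt hN hr
    refine ⟨_, mem_range_self t, ?_⟩
    rw [dist_comm, Real.dist_0_eq_abs, abs_of_pos (h.snd_pos hN t)]
    exact ht
  have h1 : (1 : ℝ) ∈ closure (range fun t => (c t).2) := by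
    refine Metric.mem_closure_iff.2 fun r hr => ?_
    obtain ⟨t, ht⟩ := h.exists_snd_gt hN (show 1 - r < 1 by linarith)
    refine ⟨_, mem_range_self t, ?_⟩
    rw [Real.dist_eq, abs_of_pos (by linarith [h.snd_lt_one hN t])]
    linarith
  obtain ⟨_, ⟨t, rfl⟩, ht⟩ := Metric.mem_closure_iff.1 (hpre.Icc_subset h0 h1 hg) η hη
  exact ⟨t, by rwa [dist_comm]⟩

end IsConnectingOrbit

/-! ### Hausdorff limits through sequences of points. -/

section HausdorffLimits

variable {Y : Type*} [MetricSpace Y] {F : ℕ → Set Y} {L : Set Y} {z : Y}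

theorem IsHausdorffLimit.of_closure (h : IsHausdorffLimit (fun n => closure (F n)) L) :
    IsHausdorffLimit F L :=
  ⟨h.1, by simpa using h.2⟩

theorem IsHausdorffLimit.exists_seq (h : IsHausdorffLimit F L) (hz : z ∈ L) :
    ∃ x : ℕ → Y, (∀ᶠ n in atTop, x n ∈ F n) ∧ Tendsto x atTop (𝓝 z) := by
  -- The extended distance may be infinite for finitely many `n`, for instance when `F n` is empty;
  -- there `y` is a dummy.
  have key : ∀ n, ∃ y, Metric.hausdorffEDist (F n) L ≠ ⊤ → y ∈ F n ∧
      edist y z ≤ Metric.hausdorffEDist (F n) L + ENNReal.ofReal (1 / ((n : ℝ) + 1)) := by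
    intro n
    by_cases htop : Metric.hausdorffEDist (F n) L = ⊤
    · exact ⟨z, fun h => absurd htop h⟩
    · have hpos : ENNReal.ofReal (1 / ((n : ℝ) + 1)) ≠ 0 := by
        rw [Ne, ENNReal.ofReal_eq_zero, not_le]
        positivity
      have hle : Metric.infEDist z (F n) ≤ Metric.hausdorffEDist (F n) L := by
        rw [Metric.hausdorffEDist_comm]
        exact Metric.infEDist_le_hausdorffEDist_of_mem hz
      obtain ⟨y, hy, hyz⟩ := Metric.infEDist_lt_iff.1
        (hle.trans_lt (ENNReal.lt_add_right htop hpos))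
      exact ⟨y, fun _ => ⟨hy, by rw [edist_comm]; exact hyz.le⟩⟩
  choose x hx using key
  have hfin := h.2.eventually_ne ENNReal.zero_ne_top
  refine ⟨x, hfin.mono fun n hn => (hx n hn).1, tendsto_iff_edist_tendsto_0.2 ?_⟩
  have hsum := h.2.add (ENNReal.tendsto_ofReal
    (tendsto_one_div_add_atTop_nhds_zero_nat (𝕜 := ℝ)))
  rw [ENNReal.ofReal_zero, add_zero] at hsum
  exact tendsto_of_tendsto_of_tendsto_of_le_of_le' tendsto_const_nhds hsum
    (Eventually.of_forall fun _ => zero_le) (hfin.mono fun n hn => (hx n hn).2)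

theorem IsHausdorffLimit.mem_of_tendsto (h : IsHausdorffLimit F L) {l : Filter ℕ} [l.NeBot]
    {n : ℕ → ℕ} (hn : Tendsto n l atTop) {x : ℕ → Y} (hx : ∀ᶠ j in l, x j ∈ F (n j))
    (hxz : Tendsto x l (𝓝 z)) : z ∈ L := by
  rw [Metric.mem_iff_infEDist_zero_of_closed h.1]
  exact tendsto_nhds_unique ((Metric.continuous_infEDist.tendsto z).comp hxz)
    (tendsto_of_tendsto_of_tendsto_of_le_of_le' tendsto_const_nhds (h.2.comp hn)
      (Eventually.of_forall fun _ => zero_le)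
      (hx.mono fun j hj => Metric.infEDist_le_hausdorffEDist_of_mem hj))

end HausdorffLimits

/-! ### Connecting orbits form slow families. -/

section Limit

variable {d : ℕ} {α β : ℝ} {f : Phase d × ℝ → Phase d} {N : Set (Phase d)} {κ : NNReal}
  {φ : ℝ → Flow ℝ (Phase d)} {R B : ℕ → Set (Phase d)} {c : ℕ → ℝ → Phase d × ℝ} {e : ℕ → ℝ}

theorem slowFamily_of_isConnectingOrbit (hf : LipschitzOnWith κ f (univ ×ˢ Ioo α β))
    (hφ : IsGeneratedBy (Ioo α β) f φ) (hN : IsCompact N) {g : ℝ} (hg : g ∈ Ioo α β)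
    (hc : ∀ n, IsConnectingOrbit (Ioo α β) f N (e n) (R n) (B n) (c n)) (he : ∀ n, 0 < e n)
    {U : Ultrafilter ℕ} (hlim : Tendsto e U (𝓝 0)) : SlowFamily (φ g) N g U c where
  mem j t := ((hc j).mem t).1
  cont j := (hc j).continuous
  anti j := (hc j).antitone_snd hN (he j)
  shift t σ x s ht hσ := by
    -- The parameter has speed at most `e j`, so over time `T` it drifts by at most `e j * T`, which
    -- tends to zero.
    have hdrift : ∀ T η : ℝ, 0 < η → ∀ᶠ j in (U : Filter ℕ), ∀ τ, |τ| ≤ T →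
        |(c j (t j + τ)).2 - g| ≤ η := by
      intro T η hη
      have h₁ : Tendsto (fun j => e j * T + |(c j (t j)).2 - g|) U (𝓝 0) := by
        have := (hlim.mul_const T).add
          ((((_root_.continuous_snd.tendsto _).comp ht).sub_const g).abs)
        simpa using! this
      filter_upwards [h₁.eventually_lt_const hη] with j hj τ hτ
      have h₂ := (hc j).abs_snd_sub_le hN (he j) (t j) (t j + τ)
      rw [add_sub_cancel_left] at h₂
      have h₃ : e j * |τ| ≤ e j * T := mul_le_mul_of_nonneg_left hτ (he j).le
      have h₄ := abs_sub_le (c j (t j + τ)).2 (c j (t j)).2 g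
      linarith
    have hfst : Tendsto (fun j => (c j (t j + σ j)).1) U (𝓝 (φ g s x)) :=
      tendsto_flow_of_drift hf hg (hφ g hg) (u := fun j τ => (c j (t j + τ)).1)
        (μ := fun j τ => (c j (t j + τ)).2)
        (fun j τ => ((hc j).hasDerivAt_fst (t j + τ)).comp_const_add (t j) τ)
        (fun j τ => ((hc j).mem _).2) hdrift
        (by simpa using! (_root_.continuous_fst.tendsto _).comp ht) hσ
    have hsnd : Tendsto (fun j => (c j (t j + σ j)).2) U (𝓝 g) := by
      rw [Metric.tendsto_nhds]
      intro r hr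
      filter_upwards [hσ.abs.eventually_lt_const (lt_add_one |s|),
        hdrift (|s| + 1) (r / 2) (by positivity)] with j h₁ h₂
      rw [Real.dist_eq]
      linarith [h₂ (σ j) h₁.le]
    exact hfst.prodMk_nhds hsnd

theorem isSlowLimit_of_isConnectingOrbit (hf : LipschitzOnWith κ f (univ ×ˢ Ioo α β))
    (hφ : IsGeneratedBy (Ioo α β) f φ) (hN : IsCompact N) (hI : Icc 0 1 ⊆ Ioo α β)
    (hc : ∀ n, IsConnectingOrbit (Ioo α β) f N (e n) (R n) (B n) (c n)) (he : ∀ n, 0 < e n)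
    (hlim : Tendsto e atTop (𝓝 0)) {C : Set (Phase d × ℝ)}
    (hC : IsHausdorffLimit (fun n => closure (range (c n))) C) : IsSlowLimit φ N c C where
  closed := hC.1
  exists_seq z hz := by
    obtain ⟨x, hx, hxz⟩ := hC.of_closure.exists_seq hz
    obtain ⟨t, ht⟩ := hx.choice
    exact ⟨t, hxz.congr' (ht.mono fun n hn => hn.symm)⟩
  mem_of_tendsto U n hn t z hz :=
    hC.of_closure.mem_of_tendsto hn (Eventually.of_forall fun j => mem_range_self (t j)) hz
  slow g hg U n hn := slowFamily_of_isConnectingOrbit hf hφ hN (hI hg) (fun j => hc (n j))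
    (fun j => he (n j)) (hlim.comp hn)
  hits g hg := by
    choose t ht using fun n : ℕ => (hc n).exists_snd_near hN hg (η := 1 / ((n : ℝ) + 1))
      (by positivity)
    exact ⟨t, tendsto_iff_dist_tendsto_zero.2 (squeeze_zero (fun _ => dist_nonneg)
      (fun n => (ht n).le) tendsto_one_div_add_atTop_nhds_zero_nat)⟩

/-- Alpha limit points are approached at arbitrarily early times, so the approximating times can be
placed before any prescribed ones. -/
theorem exists_le_tendsto_of_alphaSet {Y : Type*} [MetricSpace Y] {c : ℕ → ℝ → Y} {K : Set Y}
    (hK : IsCompact K) (h : ∀ n, ∃ w ∈ K, w ∈ alphaSet (c n)) (T : ℕ → ℝ) (U : Ultrafilter ℕ)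
    (hU : (U : Filter ℕ) ≤ atTop) :
    ∃ (a : ℕ → ℝ), ∃ z ∈ K, (∀ n, a n ≤ T n) ∧ Tendsto (fun n => c n (a n)) U (𝓝 z) := by
  choose w hwK hw using h
  choose a ha ha' using fun n => exists_le_mem_of_alphaSet (hw n)
    (Metric.ball_mem_nhds (w n) (by positivity : (0 : ℝ) < 1 / ((n : ℝ) + 1))) (T n)
  obtain ⟨z, hz, hwz⟩ := exists_tendsto_of_mem_compact hK U hwK
  refine ⟨a, z, hz, ha, (tendsto_iff_of_dist ?_).1 hwz⟩
  refine squeeze_zero (fun _ => dist_nonneg) (fun n => ?_)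
    (tendsto_one_div_add_atTop_nhds_zero_nat.mono_left hU)
  rw [dist_comm]
  exact (Metric.mem_ball.1 (ha' n)).le

theorem exists_ge_tendsto_of_omegaSet {Y : Type*} [MetricSpace Y] {c : ℕ → ℝ → Y} {K : Set Y}
    (hK : IsCompact K) (h : ∀ n, ∃ w ∈ K, w ∈ omegaSet (c n)) (T : ℕ → ℝ) (U : Ultrafilter ℕ)
    (hU : (U : Filter ℕ) ≤ atTop) :
    ∃ (a : ℕ → ℝ), ∃ z ∈ K, (∀ n, T n ≤ a n) ∧ Tendsto (fun n => c n (a n)) U (𝓝 z) := by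
  choose w hwK hw using h
  choose a ha ha' using fun n => exists_ge_mem_of_omegaSet (hw n)
    (Metric.ball_mem_nhds (w n) (by positivity : (0 : ℝ) < 1 / ((n : ℝ) + 1))) (T n)
  obtain ⟨z, hz, hwz⟩ := exists_tendsto_of_mem_compact hK U hwK
  refine ⟨a, z, hz, ha, (tendsto_iff_of_dist ?_).1 hwz⟩
  refine squeeze_zero (fun _ => dist_nonneg) (fun n => ?_)
    (tendsto_one_div_add_atTop_nhds_zero_nat.mono_left hU)
  rw [dist_comm]
  exact (Metric.mem_ball.1 (ha' n)).le

end Limit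

/-- Two functions `top`, `bot` on `(s₀, e]` which agree off their jumps, and whose jumps descend in
a finite order, have finitely many jumps; they are listed here from `e` downwards. -/
theorem exists_jump_chain {ι : Type*} {s₀ e : ℝ} {top bot : ℝ → ι} {P : Finset ι}
    {r : ι → ι → Prop} (hirr : ∀ p ∈ P, ¬ r p p)
    (htrans : ∀ p ∈ P, ∀ q ∈ P, ∀ t ∈ P, r p q → r q t → r p t)
    (hbot : ∀ s ∈ Ioc s₀ e, bot s ∈ P)
    (hjump : ∀ s ∈ Ioo s₀ e, top s ≠ bot s → r (bot s) (top s))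
    (hleft : ∀ g ∈ Ioc s₀ e, ∀ᶠ s in 𝓝[<] g, top s = bot g ∧ bot s = bot g)
    (hright : ∀ g ∈ Ioo s₀ e, ∀ᶠ s in 𝓝[>] g, top s = top g ∧ bot s = top g) :
    ∀ g ∈ Ioc s₀ e, ∃ (m : ℕ) (γ : ℕ → ℝ), γ 0 = g ∧ (∀ i ≤ m, γ i ∈ Ioc s₀ e) ∧
      (∀ i < m, γ (i + 1) < γ i ∧ bot (γ i) = top (γ (i + 1)) ∧
        top (γ (i + 1)) ≠ bot (γ (i + 1))) ∧
      ∀ s ∈ Ioo s₀ (γ m), top s = bot (γ m) ∧ bot s = bot (γ m) := by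
  let R : {q // q ∈ P} → {q // q ∈ P} → Prop := fun q q' => r q q'
  have : IsTrans _ R := ⟨fun q q' q'' h₁ h₂ => htrans _ q.2 _ q'.2 _ q''.2 h₁ h₂⟩
  have : Std.Irrefl R := ⟨fun q => hirr _ q.2⟩
  have hwf : WellFounded R := Finite.wellFounded_of_trans_of_irrefl R
  suffices H : ∀ (p : {q // q ∈ P}) (g : ℝ), g ∈ Ioc s₀ e → bot g = p →
      ∃ (m : ℕ) (γ : ℕ → ℝ), γ 0 = g ∧ (∀ i ≤ m, γ i ∈ Ioc s₀ e) ∧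
      (∀ i < m, γ (i + 1) < γ i ∧ bot (γ i) = top (γ (i + 1)) ∧
        top (γ (i + 1)) ≠ bot (γ (i + 1))) ∧
      ∀ s ∈ Ioo s₀ (γ m), top s = bot (γ m) ∧ bot s = bot (γ m) from
    fun g hg => H ⟨bot g, hbot g hg⟩ g hg rfl
  intro p
  induction p using hwf.induction with
  | _ p ih =>
  intro g hg hgp
  -- The parameters below `g` at which the labels differ from `bot g`; the supremum of this set is
  -- the next jump.
  let A : Set ℝ := {s | s ∈ Ioo s₀ g ∧ ¬ (top s = bot g ∧ bot s = bot g)}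
  rcases A.eq_empty_or_nonempty with hA | hA
  · refine ⟨0, fun _ => g, rfl, fun _ _ => hg, by simp, fun s hs => ?_⟩
    by_contra hcon
    exact (hA ▸ (⟨hs, hcon⟩ : s ∈ A) : s ∈ (∅ : Set ℝ))
  have hAb : BddAbove A := ⟨g, fun s hs => hs.1.2.le⟩
  obtain ⟨s₁, hs₁⟩ := hA
  have hσ₁ : s₀ < sSup A := hs₁.1.1.trans_le (le_csSup hAb hs₁)
  have hσ₂ : sSup A < g := by
    obtain ⟨l, hl, hl'⟩ := mem_nhdsLT_iff_exists_Ioo_subset.1 (hleft g hg)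
    refine (csSup_le ⟨s₁, hs₁⟩ fun s hs => ?_ : sSup A ≤ l).trans_lt hl
    by_contra hcon
    exact hs.2 (hl' ⟨not_le.1 hcon, hs.1.2⟩)
  have habove : ∀ s ∈ Ioo (sSup A) g, top s = bot g ∧ bot s = bot g := by
    intro s hs
    by_contra hcon
    exact absurd (le_csSup hAb (show s ∈ A from ⟨⟨hσ₁.trans hs.1, hs.2⟩, hcon⟩)) (not_le.2 hs.1)
  have hσ : sSup A ∈ Ioo s₀ e := ⟨hσ₁, hσ₂.trans_le hg.2⟩
  have htop : top (sSup A) = bot g := by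
    obtain ⟨s, hs, hs'⟩ := ((hright _ hσ).and (Ioo_mem_nhdsGT hσ₂)).exists
    rw [← hs.1, (habove s hs').1]
  -- Without a jump at the supremum, the labels would keep the value `bot g` on an interval to its
  -- left, and `A` would have a smaller upper bound.
  have hne : top (sSup A) ≠ bot (sSup A) := by
    intro heq
    obtain ⟨l, hl, hl'⟩ := mem_nhdsLT_iff_exists_Ioo_subset.1 (hleft _ ⟨hσ.1, hσ.2.le⟩)
    refine absurd (csSup_le ⟨s₁, hs₁⟩ fun s hs => ?_ : sSup A ≤ l) (not_le.2 hl)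
    by_contra hcon
    refine hs.2 ?_
    rcases (le_csSup hAb hs).lt_or_eq with hlt | heq'
    · have := hl' ⟨not_le.1 hcon, hlt⟩
      rw [mem_ofPred_eq, ← heq, htop] at this
      exact this
    · rw [heq', ← heq, htop]
      exact ⟨rfl, rfl⟩
  obtain ⟨m, γ, h0, hmem, hstep, hlast⟩ := ih ⟨bot (sSup A), hbot _ ⟨hσ.1, hσ.2.le⟩⟩
    (by
      have := hjump _ hσ hne
      rw [htop, hgp] at this
      exact this) (sSup A) ⟨hσ.1, hσ.2.le⟩ rfl
  refine ⟨m + 1, fun i => Nat.casesOn i g γ, rfl, ?_, ?_, hlast⟩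
  · rintro (_ | i) hi
    · exact hg
    · exact hmem i (by omega)
  · rintro (_ | i) hi
    · simp only [h0]
      exact ⟨hσ₂, htop.symm, hne⟩
    · exact hstep i (by omega)

/-! ### Consequences of continuation. -/

section Continuation

variable {X : Type*} [MetricSpace X] {ι : Type*} {φ : ℝ → Flow ℝ X} {N : Set X}
  {c : ℕ → ℝ → X × ℝ} {C : Set (X × ℝ)} {D : ℝ → IndexedFamily ι X} {g : ℝ} {p q : ι} {x : X}
  {I : Set ℝ}

theorem Continues.idx_eq (h : Continues φ D I) {s t : ℝ} (hs : s ∈ I) (ht : t ∈ I) :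
    (D s).idx = (D t).idx := by
  obtain ⟨P, r, h, -⟩ := h
  rw [(h s hs).1, (h t ht).1]

theorem Continues.lt_iff (h : Continues φ D I) {s t : ℝ} (hs : s ∈ I) (ht : t ∈ I)
    (hp : p ∈ (D s).idx) (hq : q ∈ (D s).idx) : (D s).lt p q ↔ (D t).lt p q := by
  obtain ⟨P, r, h, -⟩ := h
  have hP := (h s hs).1
  rw [hP] at hp hq
  rw [(h s hs).2 p hp q hq, (h t ht).2 p hp q hq]

/-- The interior of the common isolating neighborhood serves as `V`: any invariant set in it is part
of the maximal one, which is the continued Morse set. -/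
theorem Continues.exists_open (h : Continues φ D I) (hg : g ∈ I) (hp : p ∈ (D g).idx) :
    ∃ V : Set X, IsOpen V ∧ (D g).M p ⊆ V ∧ ∀ᶠ s in 𝓝[I] g, p ∈ (D s).idx ∧
      ∀ A ⊆ V, (∀ x ∈ A, ∀ t, φ s t x ∈ A) → A ⊆ (D s).M p := by
  have hidx : ∀ s ∈ I, p ∈ (D s).idx := fun s hs => h.idx_eq hg hs ▸ hp
  obtain ⟨P, r, h, hK⟩ := h
  obtain ⟨a, b, K, hag, hgb, hK⟩ := hK p ((h g hg).1 ▸ hp) g hg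
  have hg' := hK g hg hag hgb
  refine ⟨interior K, isOpen_interior, hg'.2 ▸ hg'.1.2, ?_⟩
  filter_upwards [self_mem_nhdsWithin, mem_nhdsWithin_of_mem_nhds (Ioo_mem_nhds hag hgb)]
    with s hsI hs
  refine ⟨hidx s hsI, fun A hA hinv => ?_⟩
  rw [← (hK s hsI hs.1 hs.2).2]
  exact subset_maxInv (hA.trans interior_subset) hinv

theorem IsSlowLimit.eventually_subset_of_continues (h : IsSlowLimit φ N c C)
    (hcont : Continues φ D I) (hI : I ⊆ Icc 0 1) (hg : g ∈ I) (hp : p ∈ (D g).idx)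
    {l : Filter ℝ} (hl : l ≤ 𝓝[I] g)
    (hV : ∀ V : Set X, IsOpen V → (D g).M p ⊆ V → ∀ᶠ s in l, ∀ x, (x, s) ∈ C → x ∈ V) :
    ∀ᶠ s in l, s ∈ Icc (0 : ℝ) 1 ∧ p ∈ (D s).idx ∧ ∀ x, (x, s) ∈ C → x ∈ (D s).M p := by
  obtain ⟨V, hVo, hpV, hev⟩ := hcont.exists_open hg hp
  filter_upwards [hl hev, hl self_mem_nhdsWithin, hV V hVo hpV] with s hs hsI hsV
  exact ⟨hI hsI, hs.1, hs.2 {x | (x, s) ∈ C} hsV fun x hx t => h.flow_mem (hI hsI) hx t⟩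

theorem eq_of_mem_sliceLabels (hD : IsMorseDecomposition (φ g) (maxInv (φ g) N) (D g))
    (hp : p ∈ (D g).idx) (hC : ∀ x, (x, g) ∈ C → x ∈ (D g).M p) (hq : q ∈ sliceLabels D C g) :
    q = p := by
  obtain ⟨hq, x, hx, hxC⟩ := hq
  exact hD.eq_of_mem hq hp hx (hC x hxC)

end Continuation

/-! ### One-sided limits at the breakdown parameter. -/

section OneSided

variable {d : ℕ} {ι : Type*} {α β : ℝ} {f : Phase d × ℝ → Phase d} {N : Set (Phase d)}
  {κ : NNReal} {φ : ℝ → Flow ℝ (Phase d)} {D : ℝ → IndexedFamily ι (Phase d)} {s₀ : ℝ}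
  {T : Set ℝ} {F : ℝ → Set (Phase d)} {L K : Set (Phase d)}

/-- A one-sided limit of sets that are invariant for nearby parameters is invariant. -/
theorem flow_mem_of_isLimitAlong (hf : LipschitzOnWith κ f (univ ×ˢ Ioo α β))
    (hφ : IsGeneratedBy (Ioo α β) f φ) (hT : T ⊆ Ioo α β) (hs₀ : s₀ ∈ Ioo α β)
    (hF : ∀ s ∈ T, ∀ x ∈ F s, ∀ t, φ s t x ∈ F s) (hL : IsLimitAlong T s₀ F L) {x : Phase d}
    (hx : x ∈ L) (t : ℝ) : φ s₀ t x ∈ L := by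
  obtain ⟨s, hsT, hs, hH⟩ := hL
  obtain ⟨y, hy, hyx⟩ := hH.exists_seq hx
  refine hH.mem_of_tendsto (l := atTop) tendsto_id
    (hy.mono fun n hn => hF (s n) (hsT n) (y n) hn t) ?_
  exact tendsto_flow_of_drift hf hs₀ (hφ s₀ hs₀) (u := fun j τ => φ (s j) τ (y j))
    (μ := fun j _ => s j) (fun j τ => hφ _ (hT (hsT j)) _ _) (fun j _ => hT (hsT j))
    (fun _ η hη => (Metric.tendsto_nhds.1 hs η hη).mono fun j hj _ _ => hj.le)
    (by simpa using hyx) tendsto_const_nhds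

theorem subset_of_isLimitAlong (hK : IsClosed K) (hF : ∀ᶠ s in 𝓝[T] s₀, F s ⊆ K)
    (hL : IsLimitAlong T s₀ F L) : L ⊆ K := by
  obtain ⟨s, hsT, hs, hH⟩ := hL
  intro x hx
  obtain ⟨y, hy, hyx⟩ := hH.exists_seq hx
  have hs' : Tendsto s atTop (𝓝[T] s₀) :=
    tendsto_nhdsWithin_iff.2 ⟨hs, Eventually.of_forall hsT⟩
  refine hK.mem_of_tendsto hyx ?_
  filter_upwards [hy, hs'.eventually hF] with n h₁ h₂ using h₂ h₁

/-- A closed invariant set contains the limit sets of its points, so the Morse sets at both ends of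
each orbit meet it. -/
theorem subset_span {X : Type*} [MetricSpace X] {φ : Flow ℝ X} {N L : Set X}
    {D : IndexedFamily ι X} {Q : Set ι} (hN : IsCompact N)
    (hD : IsMorseDecomposition φ (maxInv φ N) D) (hLc : IsClosed L)
    (hinv : ∀ x ∈ L, ∀ t, φ t x ∈ L) (hLN : L ⊆ N)
    (hQ : ∀ p ∈ D.idx, (D.M p ∩ L).Nonempty → p ∈ Q) : L ⊆ span φ (maxInv φ N) D Q := by
  intro x hx
  have hxS := subset_maxInv hLN hinv hx
  obtain ⟨p, hp, q, hq, hpq⟩ := hD.exists_labels hxS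
  have hpQ : p ∈ Q := by
    obtain ⟨y, hy⟩ := omegaSet_nonempty hN hxS.2
    exact hQ p hp ⟨y, hpq.2.1 hy, omegaSet_subset_of_eventually hLc
      (Eventually.of_forall fun t => hinv x hx t) hy⟩
  have hqQ : q ∈ Q := by
    obtain ⟨y, hy⟩ := alphaSet_nonempty hN hxS.2
    exact hQ q hq ⟨y, hpq.2.2 hy, alphaSet_subset_of_eventually hLc
      (Eventually.of_forall fun t => hinv x hx t) hy⟩
  exact Or.inr (mem_iUnion₂.2 ⟨p, hpQ, mem_iUnion₂.2 ⟨q, hqQ, hpq⟩⟩)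

theorem M_subset_span {X : Type*} [TopologicalSpace X] {φ : Flow ℝ X} {S : Set X}
    {D : IndexedFamily ι X} {Q : Set ι} {p : ι} (hp : p ∈ Q) : D.M p ⊆ span φ S D Q :=
  fun _ hx => Or.inl (mem_iUnion₂.2 ⟨p, hp, hx⟩)

/-- One side of the breakdown parameter `s₀`: near `s₀` in `T` the slices of `C` lie in the Morse
set with label `ζ`, and they accumulate on the Morse set with label `η` at `s₀`. -/
structure IsOneSidedApproach {X : Type*} [TopologicalSpace X] (N : Set X)
    (φ : ℝ → Flow ℝ X) (D : ℝ → IndexedFamily ι X) (C : Set (X × ℝ)) (T : Set ℝ) (s₀ : ℝ)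
    (ζ η : ι) : Prop where
  subset_Icc : T ⊆ Icc 0 1
  mem_closure : s₀ ∈ closure T
  compact : IsCompact N
  morse : ∀ s ∈ Icc (0 : ℝ) 1, IsMorseDecomposition (φ s) (maxInv (φ s) N) (D s)
  idx : ∀ s ∈ T, ζ ∈ (D s).idx
  idx₀ : η ∈ (D s₀).idx
  nonempty : ∀ s ∈ Icc (0 : ℝ) 1, ∃ x, (x, s) ∈ C
  subset : ∀ᶠ s in 𝓝[T] s₀, ∀ x, (x, s) ∈ C → x ∈ (D s).M ζ
  near : ∀ V : Set X, IsOpen V → (D s₀).M η ⊆ V → ∀ᶠ s in 𝓝[T] s₀, ∀ x, (x, s) ∈ C → x ∈ V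

namespace IsOneSidedApproach

variable {C : Set (Phase d × ℝ)} {ζ η : ι}

theorem mem_Icc (h : IsOneSidedApproach N φ D C T s₀ ζ η) : s₀ ∈ Icc (0 : ℝ) 1 :=
  closure_minimal h.subset_Icc isClosed_Icc h.mem_closure

/-- Points of the slices of `C` lie in `M ζ` and approach `M η`; a cluster point therefore witnesses
both. -/
theorem exists_limit (h : IsOneSidedApproach N φ D C T s₀ ζ η) {s : ℕ → ℝ} (hsT : ∀ n, s n ∈ T)
    (hs : Tendsto s atTop (𝓝 s₀)) : ∃ (x : ℕ → Phase d) (y : Phase d),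
      (∀ᶠ n in atTop, x n ∈ (D (s n)).M ζ) ∧ y ∈ (D s₀).M η ∧
      Tendsto x (hyperfilter ℕ : Filter ℕ) (𝓝 y) := by
  have hs' : Tendsto s atTop (𝓝[T] s₀) :=
    tendsto_nhdsWithin_iff.2 ⟨hs, Eventually.of_forall hsT⟩
  choose x hx using fun n => h.nonempty (s n) (h.subset_Icc (hsT n))
  have hxM : ∀ᶠ n in atTop, x n ∈ (D (s n)).M ζ :=
    (hs'.eventually h.subset).mono fun n hn => hn _ (hx n)
  have hxN : ∀ᶠ n in (hyperfilter ℕ : Filter ℕ), x n ∈ N :=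
    Nat.hyperfilter_le_atTop (hxM.mono fun n hn => maxInv_subset _ _
      ((h.morse _ (h.subset_Icc (hsT n))).subset ζ (h.idx _ (hsT n)) hn))
  obtain ⟨y, -, hy⟩ := h.compact.ultrafilter_le_nhds ((hyperfilter ℕ).map x)
    (le_principal_iff.2 hxN)
  refine ⟨x, y, hxM, ?_, hy⟩
  by_contra hyM
  have hcl : IsClosed ((D s₀).M η) :=
    ((h.morse s₀ h.mem_Icc).isolated η h.idx₀).isCompact.isClosed
  obtain ⟨V, hV, hMV, hVy⟩ := normal_exists_closure_subset hcl
    (isClosed_singleton (x := y)).isOpen_compl (fun z hz hzy => hyM (hzy ▸ hz))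
  have : y ∈ closure V := isClosed_closure.mem_of_tendsto hy (Nat.hyperfilter_le_atTop
    ((hs'.eventually (h.near V hV hMV)).mono fun n hn => subset_closure (hn _ (hx n))))
  exact hVy this rfl

theorem inter_nonempty (h : IsOneSidedApproach N φ D C T s₀ ζ η)
    (hL : IsLimitAlong T s₀ (fun s => (D s).M ζ) L) : ((D s₀).M η ∩ L).Nonempty := by
  obtain ⟨s, hsT, hs, hH⟩ := hL
  obtain ⟨x, y, hx, hyM, hy⟩ := h.exists_limit hsT hs
  exact ⟨y, hyM, hH.mem_of_tendsto (l := (hyperfilter ℕ : Filter ℕ))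
    (tendsto_id.mono_left Nat.hyperfilter_le_atTop) (Nat.hyperfilter_le_atTop hx) hy⟩

theorem flow_mem (h : IsOneSidedApproach N φ D C T s₀ ζ η) {s : ℝ} (hs : s ∈ T) {x : Phase d}
    (hx : x ∈ (D s).M ζ) (t : ℝ) : φ s t x ∈ (D s).M ζ :=
  ((h.morse s (h.subset_Icc hs)).isolated ζ (h.idx s hs)).flow_mem hx t

/-- The cluster point is a limit of orbits inside `M ζ`, hence inside `K`, so its whole orbit at
`s₀` stays in `K`. No Hausdorff limit of the Morse sets is needed. -/
theorem inter_maxInv_nonempty (h : IsOneSidedApproach N φ D C T s₀ ζ η)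
    (hf : LipschitzOnWith κ f (univ ×ˢ Ioo α β)) (hφ : IsGeneratedBy (Ioo α β) f φ)
    (hI : Icc 0 1 ⊆ Ioo α β) (hK : IsClosed K) (hζK : ∀ᶠ s in 𝓝[T] s₀, (D s).M ζ ⊆ K) :
    ((D s₀).M η ∩ maxInv (φ s₀) K).Nonempty := by
  obtain ⟨s, hsT, hs⟩ := mem_closure_iff_seq_limit.1 h.mem_closure
  obtain ⟨x, y, hx, hyM, hy⟩ := h.exists_limit hsT hs
  have hs' : Tendsto s atTop (𝓝[T] s₀) :=
    tendsto_nhdsWithin_iff.2 ⟨hs, Eventually.of_forall hsT⟩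
  have hflow : ∀ t, φ s₀ t y ∈ K := by
    intro t
    refine hK.mem_of_tendsto (f := fun j => φ (s j) t (x j)) (b := (hyperfilter ℕ : Filter ℕ)) ?_
      (Nat.hyperfilter_le_atTop ?_)
    · exact tendsto_flow_of_drift hf (hI h.mem_Icc) (hφ s₀ (hI h.mem_Icc))
        (u := fun j τ => φ (s j) τ (x j)) (μ := fun j _ => s j)
        (fun j τ => hφ _ (hI (h.subset_Icc (hsT j))) _ _) (fun j _ => hI (h.subset_Icc (hsT j)))
        (fun _ η hη => Nat.hyperfilter_le_atTop
          ((Metric.tendsto_nhds.1 hs η hη).mono fun j hj _ _ => hj.le))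
        (by simpa using hy) tendsto_const_nhds
    · filter_upwards [hx, hs'.eventually hζK] with n h₁ h₂ using h₂ (h.flow_mem (hsT n) h₁ t)
  exact ⟨y, hyM, by simpa using hflow 0, hflow⟩

/-- Only closedness of `K` and the inclusion of the nearby sets `M ζ` matter. Adaptedness upgrades
"meets" to "is contained in", both for `M η` and for every Morse set that meets a limit `L`. -/
theorem pair_inclusions (h : IsOneSidedApproach N φ D C T s₀ ζ η)
    (hf : LipschitzOnWith κ f (univ ×ˢ Ioo α β)) (hφ : IsGeneratedBy (Ioo α β) f φ)
    (hI : Icc 0 1 ⊆ Ioo α β) (hK : IsClosed K) (hζK : ∀ᶠ s in 𝓝[T] s₀, (D s).M ζ ⊆ K) :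
    (D s₀).M η ⊆ span (φ s₀) (slice φ N s₀) (D s₀) (labelsMeeting (D s₀) K) ∧
    (∀ L, IsLimitAlong T s₀ (fun s => (D s).M ζ) L → L ⊆ maxInv (φ s₀) K ∧
      L ⊆ span (φ s₀) (slice φ N s₀) (D s₀) (labelsMeeting (D s₀) K)) ∧
    (IsAdapted (φ s₀) (D s₀) K →
      (D s₀).M η ⊆ maxInv (φ s₀) K ∧
      (D s₀).M η ⊆ span (φ s₀) (slice φ N s₀) (D s₀) (labelsInside (D s₀) K) ∧
      ∀ L, IsLimitAlong T s₀ (fun s => (D s).M ζ) L →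
        L ⊆ span (φ s₀) (slice φ N s₀) (D s₀) (labelsInside (D s₀) K)) := by
  have hη := h.inter_maxInv_nonempty hf hφ hI hK hζK
  have hM := h.morse s₀ h.mem_Icc
  have hinv : ∀ L, IsLimitAlong T s₀ (fun s => (D s).M ζ) L → ∀ x ∈ L, ∀ t, φ s₀ t x ∈ L :=
    fun L hL x hx t => flow_mem_of_isLimitAlong hf hφ (h.subset_Icc.trans hI) (hI h.mem_Icc)
      (fun s hs x hx t => h.flow_mem hs hx t) hL hx t
  have hLN : ∀ L, IsLimitAlong T s₀ (fun s => (D s).M ζ) L → L ⊆ N := fun L hL =>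
    subset_of_isLimitAlong h.compact.isClosed (eventually_nhdsWithin_of_forall fun s hs =>
      ((h.morse s (h.subset_Icc hs)).subset ζ (h.idx s hs)).trans (maxInv_subset _ _)) hL
  have hLK : ∀ L, IsLimitAlong T s₀ (fun s => (D s).M ζ) L → L ⊆ K := fun L hL =>
    subset_of_isLimitAlong hK hζK hL
  have hLcl : ∀ L, IsLimitAlong T s₀ (fun s => (D s).M ζ) L → IsClosed L := by
    rintro L ⟨s, -, -, hH⟩
    exact hH.1
  refine ⟨M_subset_span ⟨h.idx₀, hη.mono (inter_subset_inter_right _ (maxInv_subset _ _))⟩,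
    fun L hL => ⟨subset_maxInv (hLK L hL) (hinv L hL),
      subset_span h.compact hM (hLcl L hL) (hinv L hL) (hLN L hL) fun p hp hpL =>
        ⟨hp, hpL.mono (inter_subset_inter_right _ (hLK L hL))⟩⟩, fun had => ?_⟩
  have hηK := had η h.idx₀ hη
  exact ⟨subset_maxInv hηK fun x hx t => (hM.isolated η h.idx₀).flow_mem hx t,
    M_subset_span ⟨h.idx₀, hηK⟩, fun L hL =>
      subset_span h.compact hM (hLcl L hL) (hinv L hL) (hLN L hL) fun p hp hpL =>
        ⟨hp, had p hp (hpL.mono (inter_subset_inter_right _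
          (subset_maxInv (hLK L hL) (hinv L hL))))⟩⟩

end IsOneSidedApproach

end OneSided

/-! ### The slices at the parameters one and zero. -/

section EndSlices

variable {d : ℕ} {ι : Type*} {α β : ℝ} {f : Phase d × ℝ → Phase d} {N : Set (Phase d)}
  {φ : ℝ → Flow ℝ (Phase d)} {D : ℝ → IndexedFamily ι (Phase d)} {c : ℕ → ℝ → Phase d × ℝ}
  {C : Set (Phase d × ℝ)} {e : ℕ → ℝ} {R B : ℕ → Set (Phase d)} {p : ι}

/-- Any point of the slice at `1` is preceded along the curves by points converging to `M p`, so its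
label lies below `p`. -/
theorem isFlowSup_one (h : IsSlowLimit φ N c C) (hN : IsCompact N)
    (hD : IsMorseDecomposition (φ 1) (maxInv (φ 1) N) (D 1)) (hp : p ∈ (D 1).idx)
    (hc : ∀ n, IsConnectingOrbit (Ioo α β) f N (e n) ((D 1).M p) (B n) (c n)) :
    IsFlowSup (φ 1) (maxInv (φ 1) N) (D 1) (sliceLabels D C 1) p := by
  have hv := h.slow_hyperfilter (g := 1) (by simp)
  have key := exists_le_tendsto_of_alphaSet (c := c) (K := (D 1).M p ×ˢ {(1 : ℝ)})
    ((hD.isolated p hp).isCompact.prod isCompact_singleton) (fun n => by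
      obtain ⟨x, hx, hxα⟩ := (hc n).exists_alpha hN
      exact ⟨(x, 1), ⟨hx, rfl⟩, hxα⟩)
  refine ⟨⟨hp, ?_⟩, ?_⟩
  · obtain ⟨a, ⟨x, s⟩, ⟨hx, hs⟩, -, ha⟩ := key 0 _ Nat.hyperfilter_le_atTop
    obtain rfl : s = 1 := hs
    exact ⟨x, hx, h.mem_of_tendsto (hyperfilter ℕ) id
      (tendsto_id.mono_left Nat.hyperfilter_le_atTop) _ _ ha⟩
  · rintro q ⟨hq, y, hy, hyC⟩
    obtain ⟨t, ht⟩ := h.exists_seq _ hyC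
    obtain ⟨a, ⟨x, s⟩, ⟨hx, hs⟩, hat, ha⟩ := key t _ Nat.hyperfilter_le_atTop
    obtain rfl : s = 1 := hs
    exact hv.flowLE_of_mem hN hD hp hq ha (ht.mono_left Nat.hyperfilter_le_atTop)
      (Eventually.of_forall hat) hx hy

theorem isFlowInf_zero (h : IsSlowLimit φ N c C) (hN : IsCompact N)
    (hD : IsMorseDecomposition (φ 0) (maxInv (φ 0) N) (D 0)) (hp : p ∈ (D 0).idx)
    (hc : ∀ n, IsConnectingOrbit (Ioo α β) f N (e n) (R n) ((D 0).M p) (c n)) :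
    IsFlowInf (φ 0) (maxInv (φ 0) N) (D 0) (sliceLabels D C 0) p := by
  have hv := h.slow_hyperfilter (g := 0) (by simp)
  have key := exists_ge_tendsto_of_omegaSet (c := c) (K := (D 0).M p ×ˢ {(0 : ℝ)})
    ((hD.isolated p hp).isCompact.prod isCompact_singleton) (fun n => by
      obtain ⟨x, hx, hxα⟩ := (hc n).exists_omega hN
      exact ⟨(x, 0), ⟨hx, rfl⟩, hxα⟩)
  refine ⟨⟨hp, ?_⟩, ?_⟩
  · obtain ⟨a, ⟨x, s⟩, ⟨hx, hs⟩, -, ha⟩ := key 0 _ Nat.hyperfilter_le_atTop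
    obtain rfl : s = 0 := hs
    exact ⟨x, hx, h.mem_of_tendsto (hyperfilter ℕ) id
      (tendsto_id.mono_left Nat.hyperfilter_le_atTop) _ _ ha⟩
  · rintro q ⟨hq, y, hy, hyC⟩
    obtain ⟨t, ht⟩ := h.exists_seq _ hyC
    obtain ⟨a, ⟨x, s⟩, ⟨hx, hs⟩, hat, ha⟩ := key t _ Nat.hyperfilter_le_atTop
    obtain rfl : s = 0 := hs
    exact hv.flowLE_of_mem hN hD hq hp (ht.mono_left Nat.hyperfilter_le_atTop) ha
      (Eventually.of_forall hat) hy hx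

end EndSlices

/-! ### Greatest and least labels and their jumps. -/

section Jumps

variable {X : Type*} [MetricSpace X] {ι : Type*} {φ : ℝ → Flow ℝ X} {N : Set X}
  {c : ℕ → ℝ → X × ℝ} {C : Set (X × ℝ)} {D : ℝ → IndexedFamily ι X} {s₀ : ℝ} {top bot : ℝ → ι}

/-- Choices of the largest and the least label of every slice of `C`. -/
structure IsSliceBounds (φ : ℝ → Flow ℝ X) (N : Set X) (C : Set (X × ℝ))
    (D : ℝ → IndexedFamily ι X) (top bot : ℝ → ι) : Prop where
  compact : IsCompact N
  morse : ∀ s ∈ Icc (0 : ℝ) 1, IsMorseDecomposition (φ s) (maxInv (φ s) N) (D s)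
  sup : ∀ s ∈ Icc (0 : ℝ) 1, IsFlowSup (φ s) (maxInv (φ s) N) (D s) (sliceLabels D C s) (top s)
  inf : ∀ s ∈ Icc (0 : ℝ) 1, IsFlowInf (φ s) (maxInv (φ s) N) (D s) (sliceLabels D C s) (bot s)

namespace IsSliceBounds

theorem exists_of_isSlowLimit [Nonempty ι] (h : IsSlowLimit φ N c C) (hN : IsCompact N)
    (hD : ∀ s ∈ Icc (0 : ℝ) 1, IsMorseDecomposition (φ s) (maxInv (φ s) N) (D s)) :
    ∃ top bot, IsSliceBounds φ N C D top bot := by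
  have h₁ : ∀ s, ∃ p, s ∈ Icc (0 : ℝ) 1 →
      IsFlowSup (φ s) (maxInv (φ s) N) (D s) (sliceLabels D C s) p := fun s => by
    by_cases hs : s ∈ Icc (0 : ℝ) 1
    · exact (h.exists_isFlowSup hN hs (hD s hs)).imp fun _ hp _ => hp
    · exact ⟨Classical.arbitrary ι, fun h => absurd h hs⟩
  have h₂ : ∀ s, ∃ p, s ∈ Icc (0 : ℝ) 1 →
      IsFlowInf (φ s) (maxInv (φ s) N) (D s) (sliceLabels D C s) p := fun s => by
    by_cases hs : s ∈ Icc (0 : ℝ) 1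
    · exact (h.exists_isFlowInf hN hs (hD s hs)).imp fun _ hp _ => hp
    · exact ⟨Classical.arbitrary ι, fun h => absurd h hs⟩
  choose top htop using h₁
  choose bot hbot using h₂
  exact ⟨top, bot, hN, hD, htop, hbot⟩

theorem top_mem (hB : IsSliceBounds φ N C D top bot)
    {s : ℝ} (hs : s ∈ Icc (0 : ℝ) 1) : top s ∈ (D s).idx := (hB.sup s hs).1.1

theorem bot_mem (hB : IsSliceBounds φ N C D top bot)
    {s : ℝ} (hs : s ∈ Icc (0 : ℝ) 1) : bot s ∈ (D s).idx := (hB.inf s hs).1.1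

theorem bot_le_top (hB : IsSliceBounds φ N C D top bot) {s : ℝ} (hs : s ∈ Icc (0 : ℝ) 1) :
    flowLE (φ s) (maxInv (φ s) N) (D s) (bot s) (top s) :=
  (hB.inf s hs).2 _ (hB.sup s hs).1

theorem bot_lt_top (hB : IsSliceBounds φ N C D top bot)
    {s : ℝ} (hs : s ∈ Icc (0 : ℝ) 1) (hne : top s ≠ bot s) :
    flowLT (φ s) (maxInv (φ s) N) (D s) (bot s) (top s) :=
  (hB.bot_le_top hs).resolve_left hne.symm

theorem top_eq (hB : IsSliceBounds φ N C D top bot) {s : ℝ} (hs : s ∈ Icc (0 : ℝ) 1) {p : ι}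
    (hp : IsFlowSup (φ s) (maxInv (φ s) N) (D s) (sliceLabels D C s) p) : top s = p :=
  (hB.morse s hs).flowLE_antisymm hB.compact (hp.2 _ (hB.sup s hs).1) ((hB.sup s hs).2 _ hp.1)

theorem bot_eq (hB : IsSliceBounds φ N C D top bot) {s : ℝ} (hs : s ∈ Icc (0 : ℝ) 1) {p : ι}
    (hp : IsFlowInf (φ s) (maxInv (φ s) N) (D s) (sliceLabels D C s) p) : bot s = p :=
  (hB.morse s hs).flowLE_antisymm hB.compact ((hB.inf s hs).2 _ hp.1) (hp.2 _ (hB.inf s hs).1)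

theorem eventually_eq (hB : IsSliceBounds φ N C D top bot)
    (h : IsSlowLimit φ N c C) {I : Set ℝ} (hcont : Continues φ D I)
    (hI : I ⊆ Icc 0 1) {g : ℝ} (hg : g ∈ I) {p : ι} (hp : p ∈ (D g).idx) {l : Filter ℝ}
    (hl : l ≤ 𝓝[I] g)
    (hV : ∀ V : Set X, IsOpen V → (D g).M p ⊆ V → ∀ᶠ s in l, ∀ x, (x, s) ∈ C → x ∈ V) :
    ∀ᶠ s in l, top s = p ∧ bot s = p := by
  filter_upwards [h.eventually_subset_of_continues hcont hI hg hp hl hV] with s hs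
  have hM := hB.morse s hs.1
  exact ⟨eq_of_mem_sliceLabels hM hs.2.1 hs.2.2 (hB.sup s hs.1).1,
    eq_of_mem_sliceLabels hM hs.2.1 hs.2.2 (hB.inf s hs.1).1⟩

theorem eventually_left (hB : IsSliceBounds φ N C D top bot)
    (h : IsSlowLimit φ N c C) {I : Set ℝ} (hcont : Continues φ D I)
    (hI : I ⊆ Icc 0 1) {g : ℝ} (hg : g ∈ I) (hl : I ∈ 𝓝[<] g) :
    ∀ᶠ s in 𝓝[<] g, top s = bot g ∧ bot s = bot g :=
  hB.eventually_eq h hcont hI hg (hB.bot_mem (hI hg))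
    (le_inf nhdsWithin_le_nhds (le_principal_iff.2 hl)) fun _ hV hpV =>
      h.eventually_left hB.compact (hI hg) (hB.morse g (hI hg)) (hB.inf g (hI hg)) hV hpV

theorem eventually_right (hB : IsSliceBounds φ N C D top bot)
    (h : IsSlowLimit φ N c C) {I : Set ℝ} (hcont : Continues φ D I)
    (hI : I ⊆ Icc 0 1) {g : ℝ} (hg : g ∈ I) (hl : I ∈ 𝓝[>] g) :
    ∀ᶠ s in 𝓝[>] g, top s = top g ∧ bot s = top g :=
  hB.eventually_eq h hcont hI hg (hB.top_mem (hI hg))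
    (le_inf nhdsWithin_le_nhds (le_principal_iff.2 hl)) fun _ hV hpV =>
      h.eventually_right hB.compact (hI hg) (hB.morse g (hI hg)) (hB.sup g (hI hg)) hV hpV

/-- A slice with a single label consists of points connecting one Morse set to itself, which lie in
it. -/
theorem mem_M (hB : IsSliceBounds φ N C D top bot)
    {s : ℝ} (hs : s ∈ Icc (0 : ℝ) 1) (h : IsSlowLimit φ N c C) (heq : top s = bot s)
    {x : X} (hx : (x, s) ∈ C) : x ∈ (D s).M (top s) := by
  have hM := hB.morse s hs
  have huniq : ∀ q ∈ sliceLabels D C s, q = top s := fun q hq =>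
    hM.flowLE_antisymm hB.compact ((hB.sup s hs).2 q hq) (heq ▸ (hB.inf s hs).2 q hq)
  obtain ⟨p, hp, q, hq, hpq⟩ := h.exists_labels hB.compact hs hM hx
  obtain rfl := huniq p hp
  obtain rfl := huniq q hq
  rcases hM.connecting_cases hB.compact hp.1 hp.1 hpq with h' | h'
  · exact h'.2
  · exact absurd h'.1 (hM.irrefl _ hp.1)

theorem exists_right_chain (hB : IsSliceBounds φ N C D top bot)
    (h : IsSlowLimit φ N c C) (hs₀ : s₀ ∈ Ioo (0 : ℝ) 1)
    (hcont : Continues φ D (Ioc s₀ 1)) :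
    ∃ (m : ℕ) (γ : ℕ → ℝ), γ 0 = 1 ∧ (∀ i ≤ m, γ i ∈ Ioc s₀ 1) ∧
      (∀ i < m, γ (i + 1) < γ i ∧ bot (γ i) = top (γ (i + 1)) ∧
        top (γ (i + 1)) ≠ bot (γ (i + 1))) ∧
      ∀ s ∈ Ioo s₀ (γ m), top s = bot (γ m) ∧ bot s = bot (γ m) := by
  have hI : Ioc s₀ 1 ⊆ Icc (0 : ℝ) 1 := fun s hs => ⟨hs₀.1.le.trans hs.1.le, hs.2⟩
  have h1 : (1 : ℝ) ∈ Ioc s₀ 1 := ⟨hs₀.2, le_rfl⟩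
  have hM := hB.morse 1 (hI h1)
  refine exists_jump_chain (P := (D 1).idx) (r := (D 1).lt) hM.irrefl hM.trans
    (fun s hs => hcont.idx_eq hs h1 ▸ hB.bot_mem (hI hs)) (fun s hs hne => ?_)
    (fun g hg => hB.eventually_left h hcont hI hg ?_)
    (fun g hg => hB.eventually_right h hcont hI ⟨hg.1, hg.2.le⟩ ?_) 1 h1
  · have hs' : s ∈ Ioc s₀ 1 := ⟨hs.1, hs.2.le⟩
    have := (hB.morse s (hI hs')).lt_of_flowLT hB.compact (hB.bot_lt_top (hI hs') hne)
    exact (hcont.lt_iff hs' h1 this.1 this.2.1).1 this.2.2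
  · filter_upwards [Ioo_mem_nhdsLT hg.1] with s hs using ⟨hs.1, hs.2.le.trans hg.2⟩
  · filter_upwards [Ioo_mem_nhdsGT hg.2] with s hs using ⟨hg.1.trans hs.1, hs.2.le⟩

theorem exists_left_chain (hB : IsSliceBounds φ N C D top bot)
    (h : IsSlowLimit φ N c C) (hs₀ : s₀ ∈ Ioo (0 : ℝ) 1)
    (hcont : Continues φ D (Ico 0 s₀)) :
    ∃ (m : ℕ) (γ : ℕ → ℝ), γ 0 = 0 ∧ (∀ i ≤ m, γ i ∈ Ico 0 s₀) ∧
      (∀ i < m, γ i < γ (i + 1) ∧ top (γ i) = bot (γ (i + 1)) ∧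
        top (γ (i + 1)) ≠ bot (γ (i + 1))) ∧
      ∀ s ∈ Ioo (γ m) s₀, top s = top (γ m) ∧ bot s = top (γ m) := by
  have hI : Ico 0 s₀ ⊆ Icc (0 : ℝ) 1 := fun s hs => ⟨hs.1, hs.2.le.trans hs₀.2.le⟩
  have h0 : (0 : ℝ) ∈ Ico 0 s₀ := ⟨le_rfl, hs₀.1⟩
  have hM := hB.morse 0 (hI h0)
  -- Reflecting the parameter swaps left with right and `top` with `bot`, and reverses the order, so
  -- the descending construction can be reused.
  have hneg : ∀ s ∈ Ioc (-s₀) 0, -s ∈ Ico 0 s₀ := fun s hs =>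
    ⟨neg_nonneg.2 hs.2, by linarith [hs.1]⟩
  have hjump : ∀ s ∈ Ioo (-s₀) 0, bot (-s) ≠ top (-s) → (D 0).lt (bot (-s)) (top (-s)) := by
    intro s hs hne
    have hs' := hneg s ⟨hs.1, hs.2.le⟩
    have := (hB.morse _ (hI hs')).lt_of_flowLT hB.compact (hB.bot_lt_top (hI hs') hne.symm)
    exact (hcont.lt_iff hs' h0 this.1 this.2.1).1 this.2.2
  have hleft : ∀ g ∈ Ioc (-s₀) 0, ∀ᶠ s in 𝓝[<] g, bot (-s) = top (-g) ∧ top (-s) = top (-g) := by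
    intro g hg
    have hg' := hneg g hg
    refine (tendsto_neg_nhdsLT.eventually (hB.eventually_right h hcont hI hg' ?_)).mono
      fun s hs => hs.symm
    filter_upwards [Ioo_mem_nhdsGT hg'.2] with s hs using ⟨hg'.1.trans hs.1.le, hs.2⟩
  have hright : ∀ g ∈ Ioo (-s₀) 0, ∀ᶠ s in 𝓝[>] g, bot (-s) = bot (-g) ∧ top (-s) = bot (-g) := by
    intro g hg
    have hg' := hneg g ⟨hg.1, hg.2.le⟩
    refine (tendsto_neg_nhdsGT.eventually (hB.eventually_left h hcont hI hg' ?_)).mono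
      fun s hs => hs.symm
    filter_upwards [Ioo_mem_nhdsLT (neg_pos.2 hg.2)] with s hs using
      ⟨hs.1.le, hs.2.trans hg'.2⟩
  obtain ⟨m, γ, hγ0, hmem, hstep, hlast⟩ := exists_jump_chain (s₀ := -s₀) (e := 0)
    (top := fun s => bot (-s)) (bot := fun s => top (-s)) (P := (D 0).idx)
    (r := fun p q => (D 0).lt q p) hM.irrefl
    (fun p hp q hq t ht h₁ h₂ => hM.trans t ht q hq p hp h₂ h₁)
    (fun s hs => hcont.idx_eq (hneg s hs) h0 ▸ hB.top_mem (hI (hneg s hs)))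
    hjump hleft hright 0 ⟨by linarith [hs₀.1], le_rfl⟩
  refine ⟨m, fun i => -γ i, by simp [hγ0], fun i hi => hneg _ (hmem i hi),
    fun i hi => ⟨neg_lt_neg (hstep i hi).1, (hstep i hi).2.1, (hstep i hi).2.2.symm⟩,
    fun s hs => ?_⟩
  have := hlast (-s) ⟨by linarith [hs.2], by linarith [hs.1]⟩
  simp only [neg_neg] at this
  exact this.symm

theorem approach_right (hB : IsSliceBounds φ N C D top bot)
    (h : IsSlowLimit φ N c C) (hs₀ : s₀ ∈ Ioo (0 : ℝ) 1)
    (hcont : Continues φ D (Ioc s₀ 1)) {g : ℝ} {ζ : ι} (hg : g ∈ Ioc s₀ 1) (hζ : ζ ∈ (D g).idx)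
    (hconst : ∀ s ∈ Ioo s₀ g, top s = ζ ∧ bot s = ζ) :
    IsOneSidedApproach N φ D C (Ioc s₀ 1) s₀ ζ (top s₀) := by
  have hI : Ioc s₀ 1 ⊆ Icc (0 : ℝ) 1 := fun s hs => ⟨hs₀.1.le.trans hs.1.le, hs.2⟩
  have hs₀' : s₀ ∈ Icc (0 : ℝ) 1 := Ioo_subset_Icc_self hs₀
  refine ⟨hI, ?_, hB.compact, hB.morse, fun s hs => hcont.idx_eq hg hs ▸ hζ, hB.top_mem hs₀',
    fun s hs => h.exists_mem hB.compact hs, ?_, fun V hV hpV => ?_⟩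
  · rw [closure_Ioc hs₀.2.ne]
    exact left_mem_Icc.2 hs₀.2.le
  · filter_upwards [nhdsWithin_mono _ Ioc_subset_Ioi_self (Ioo_mem_nhdsGT hg.1)] with s hs x hx
    have hc := hconst s hs
    rw [← hc.1]
    exact hB.mem_M (hI ⟨hs.1, hs.2.le.trans hg.2⟩) h (hc.1.trans hc.2.symm) hx
  · exact nhdsWithin_mono _ Ioc_subset_Ioi_self
      (h.eventually_right hB.compact hs₀' (hB.morse _ hs₀') (hB.sup _ hs₀') hV hpV)

theorem approach_left (hB : IsSliceBounds φ N C D top bot)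
    (h : IsSlowLimit φ N c C) (hs₀ : s₀ ∈ Ioo (0 : ℝ) 1)
    (hcont : Continues φ D (Ico 0 s₀)) {g : ℝ} {ζ : ι} (hg : g ∈ Ico 0 s₀) (hζ : ζ ∈ (D g).idx)
    (hconst : ∀ s ∈ Ioo g s₀, top s = ζ ∧ bot s = ζ) :
    IsOneSidedApproach N φ D C (Ico 0 s₀) s₀ ζ (bot s₀) := by
  have hI : Ico 0 s₀ ⊆ Icc (0 : ℝ) 1 := fun s hs => ⟨hs.1, hs.2.le.trans hs₀.2.le⟩
  have hs₀' : s₀ ∈ Icc (0 : ℝ) 1 := Ioo_subset_Icc_self hs₀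
  refine ⟨hI, ?_, hB.compact, hB.morse, fun s hs => hcont.idx_eq hg hs ▸ hζ, hB.bot_mem hs₀',
    fun s hs => h.exists_mem hB.compact hs, ?_, fun V hV hpV => ?_⟩
  · rw [closure_Ico hs₀.1.ne]
    exact right_mem_Icc.2 hs₀.1.le
  · filter_upwards [nhdsWithin_mono _ Ico_subset_Iio_self (Ioo_mem_nhdsLT hg.2)] with s hs x hx
    have hc := hconst s hs
    rw [← hc.1]
    exact hB.mem_M (hI ⟨hg.1.trans hs.1.le, hs.2⟩) h (hc.1.trans hc.2.symm) hx
  · exact nhdsWithin_mono _ Ico_subset_Iio_self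
      (h.eventually_left hB.compact hs₀' (hB.morse _ hs₀') (hB.inf _ hs₀') hV hpV)

end IsSliceBounds

end Jumps

/-! ### Neighborhoods of continuable pairs. -/

section PairNeighborhoods

variable {X : Type*} [TopologicalSpace X] {ι : Type*} {φ : ℝ → Flow ℝ X} {N K : Set X}
  {D : ℝ → IndexedFamily ι X} {s₀ a b : ℝ} {J J' : Set ι} {p : ι}

theorem IsPairNbhd.isClosed [T2Space X] (h : IsPairNbhd φ N D s₀ J J' K a b) : IsClosed K :=
  (h.isolating s₀ ⟨h.a_mem.2.le, h.b_mem.1.le⟩).1.isClosed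

theorem IsPairNbhd.eventually_right (h : IsPairNbhd φ N D s₀ J J' K a b) (hp : p ∈ J') :
    ∀ᶠ s in 𝓝[Ioc s₀ 1] s₀, (D s).M p ⊆ K := by
  filter_upwards [nhdsWithin_mono _ Ioc_subset_Ioi_self (Ioo_mem_nhdsGT h.b_mem.1)] with s hs
  exact (h.right s ⟨hs.1, hs.2.le⟩ ▸ M_subset_span hp : (D s).M p ⊆ maxInv (φ s) K).trans
    (maxInv_subset _ _)

theorem IsPairNbhd.eventually_left (h : IsPairNbhd φ N D s₀ J J' K a b) (hp : p ∈ J) :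
    ∀ᶠ s in 𝓝[Ico 0 s₀] s₀, (D s).M p ⊆ K := by
  filter_upwards [nhdsWithin_mono _ Ico_subset_Iio_self (Ioo_mem_nhdsLT h.a_mem.2)] with s hs
  exact (h.left s ⟨hs.1.le, hs.2⟩ ▸ M_subset_span hp : (D s).M p ⊆ maxInv (φ s) K).trans
    (maxInv_subset _ _)

end PairNeighborhoods

end Conley

/-! ### Assembly of the chain. -/

theorem mainTheorem3 {d : ℕ} {ι : Type*} {A : Type*} [Finite A]
    -- the family of vector fields, its flows, the isolating neighborhood and Morse decompositions
    (δ : ℝ) (hδ : 0 < δ)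
    (f : Conley.Phase d × ℝ → Conley.Phase d)
    (hf : ∃ κ : NNReal, LipschitzOnWith κ f (Set.univ ×ˢ Set.Ioo (-2 * δ) (1 + 2 * δ)))
    (φ : ℝ → Flow ℝ (Conley.Phase d))
    (hφ : Conley.IsGeneratedBy (Set.Ioo (-2 * δ) (1 + 2 * δ)) f φ)
    (N : Set (Conley.Phase d))
    (D : ℝ → Conley.IndexedFamily ι (Conley.Phase d))
    (s₀ : ℝ)
    (hD : Conley.Breakdown (Set.Ioo (-2 * δ) (1 + 2 * δ)) φ N D s₀)
    -- connecting orbits for all small drift speeds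
    (ε₀ : ℝ) (hε₀ : ε₀ ∈ Set.Ioo (0 : ℝ) 1)
    (ρ π : ι) (hρ : ρ ∈ (D 1).idx) (hπ : π ∈ (D 0).idx)
    (c : ℝ → ℝ → Conley.Phase d × ℝ)
    (hc : ∀ ε ∈ Set.Ioo (0 : ℝ) ε₀, Conley.IsConnectingOrbit (Set.Ioo (-2 * δ) (1 + 2 * δ)) f N ε
      ((D 1).M ρ) ((D 0).M π) (c ε))
    -- the finest decomposition
    (J J' : A → Set ι)
    (hJ : Conley.IsFinestDecomposition φ N D s₀ J J')
    -- a Hausdorff limit of closures of connecting orbits as the drift speed tends to zero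
    (ε : ℕ → ℝ) (hε : ∀ n, ε n ∈ Set.Ioo (0 : ℝ) ε₀) (hε_lim : Tendsto ε atTop (𝓝 0))
    (C : Set (Conley.Phase d × ℝ))
    (hC : Conley.IsHausdorffLimit (fun n => closure (Set.range (c (ε n)))) C) :
    ∃ (l k : ℕ) (γ : ℕ → ℝ) (ξ : ℕ → ι) (η η' : ι),
      -- the parameters
      1 ≤ l ∧ l ≤ k ∧ γ 0 = 1 ∧ γ l = s₀ ∧ γ (k + 1) = 0 ∧ (∀ i ≤ k, γ (i + 1) < γ i) ∧
      -- the indices; `η` and `η'` are the two indices at the parameter `s₀`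
      (∀ i ≤ l, ξ i ∈ (D 1).idx) ∧
      (∀ i, l + 1 ≤ i → i ≤ k + 2 → ξ i ∈ (D 0).idx) ∧
      η ∈ (D s₀).idx ∧ η' ∈ (D s₀).idx ∧
      -- the flow-defined orders along the chain
      (∀ i, 1 ≤ i → i ≤ k → i ≠ l →
        Conley.flowLT (φ (γ i)) (Conley.slice φ N (γ i)) (D (γ i)) (ξ (i + 1)) (ξ i)) ∧
      Conley.flowLE (φ s₀) (Conley.slice φ N s₀) (D s₀) η' η ∧
      -- the end slices
      ξ 0 = ρ ∧
      Conley.IsFlowSup (φ 1) (Conley.slice φ N 1) (D 1) (Conley.sliceLabels D C 1) (ξ 0) ∧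
      Conley.IsFlowInf (φ 1) (Conley.slice φ N 1) (D 1) (Conley.sliceLabels D C 1) (ξ 1) ∧
      Conley.IsFlowSup (φ 0) (Conley.slice φ N 0) (D 0) (Conley.sliceLabels D C 0) (ξ (k + 1)) ∧
      Conley.IsFlowInf (φ 0) (Conley.slice φ N 0) (D 0) (Conley.sliceLabels D C 0) (ξ (k + 2)) ∧
      ξ (k + 2) = π ∧
      -- the Morse sets at `s₀` meet the one-sided limits
      (∀ L, Conley.IsLimitAlong (Set.Ioc s₀ 1) s₀ (fun s => (D s).M (ξ l)) L →
        ((D s₀).M η ∩ L).Nonempty) ∧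
      (∀ L, Conley.IsLimitAlong (Set.Ico 0 s₀) s₀ (fun s => (D s).M (ξ (l + 1))) L →
        ((D s₀).M η' ∩ L).Nonempty) ∧
      -- inclusions at `s₀` for the pair that contains `ξ l`
      (∀ (i : A) (K : Set (Conley.Phase d)) (a b : ℝ), ξ l ∈ J' i →
        Conley.IsPairNbhd φ N D s₀ (J i) (J' i) K a b →
        (D s₀).M η ⊆
          Conley.span (φ s₀) (Conley.slice φ N s₀) (D s₀) (Conley.labelsMeeting (D s₀) K) ∧
        (∀ L, Conley.IsLimitAlong (Set.Ioc s₀ 1) s₀ (fun s => (D s).M (ξ l)) L →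
          L ⊆ Conley.maxInv (φ s₀) K ∧
          L ⊆ Conley.span (φ s₀) (Conley.slice φ N s₀) (D s₀) (Conley.labelsMeeting (D s₀) K)) ∧
        (Conley.IsAdapted (φ s₀) (D s₀) K →
          (D s₀).M η ⊆ Conley.maxInv (φ s₀) K ∧
          (D s₀).M η ⊆
            Conley.span (φ s₀) (Conley.slice φ N s₀) (D s₀) (Conley.labelsInside (D s₀) K) ∧
          ∀ L, Conley.IsLimitAlong (Set.Ioc s₀ 1) s₀ (fun s => (D s).M (ξ l)) L →
            L ⊆ Conley.span (φ s₀) (Conley.slice φ N s₀) (D s₀)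
              (Conley.labelsInside (D s₀) K))) ∧
      -- inclusions at `s₀` for the pair that contains `ξ (l + 1)`
      (∀ (i : A) (K : Set (Conley.Phase d)) (a b : ℝ), ξ (l + 1) ∈ J i →
        Conley.IsPairNbhd φ N D s₀ (J i) (J' i) K a b →
        (D s₀).M η' ⊆
          Conley.span (φ s₀) (Conley.slice φ N s₀) (D s₀) (Conley.labelsMeeting (D s₀) K) ∧
        (∀ L, Conley.IsLimitAlong (Set.Ico 0 s₀) s₀ (fun s => (D s).M (ξ (l + 1))) L →
          L ⊆ Conley.maxInv (φ s₀) K ∧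
          L ⊆ Conley.span (φ s₀) (Conley.slice φ N s₀) (D s₀) (Conley.labelsMeeting (D s₀) K)) ∧
        (Conley.IsAdapted (φ s₀) (D s₀) K →
          (D s₀).M η' ⊆ Conley.maxInv (φ s₀) K ∧
          (D s₀).M η' ⊆
            Conley.span (φ s₀) (Conley.slice φ N s₀) (D s₀) (Conley.labelsInside (D s₀) K) ∧
          ∀ L, Conley.IsLimitAlong (Set.Ico 0 s₀) s₀ (fun s => (D s).M (ξ (l + 1))) L →
            L ⊆ Conley.span (φ s₀) (Conley.slice φ N s₀) (D s₀)
              (Conley.labelsInside (D s₀) K))) := by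
  obtain ⟨κ, hf⟩ := hf
  have hI : Set.Icc (0 : ℝ) 1 ⊆ Set.Ioo (-2 * δ) (1 + 2 * δ) := fun s hs =>
    ⟨by linarith [hs.1], by linarith [hs.2]⟩
  have hN : IsCompact N := (hD.isolating 0 (hI ⟨le_rfl, zero_le_one⟩)).1
  have hM : ∀ s ∈ Set.Icc (0 : ℝ) 1,
      Conley.IsMorseDecomposition (φ s) (Conley.maxInv (φ s) N) (D s) :=
    fun s hs => hD.morse s (hI hs)
  have h : Conley.IsSlowLimit φ N (fun n => c (ε n)) C :=
    Conley.isSlowLimit_of_isConnectingOrbit hf hφ hN hI (fun n => hc _ (hε n))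
      (fun n => (hε n).1) hε_lim hC
  have : Nonempty ι := ⟨ρ⟩
  obtain ⟨top, bot, hB⟩ := Conley.IsSliceBounds.exists_of_isSlowLimit h hN hM
  have h0 : (0 : ℝ) ∈ Set.Icc (0 : ℝ) 1 := ⟨le_rfl, zero_le_one⟩
  have h1 : (1 : ℝ) ∈ Set.Icc (0 : ℝ) 1 := ⟨zero_le_one, le_rfl⟩
  have hs₀ := hD.mem
  have hs₀' : s₀ ∈ Set.Icc (0 : ℝ) 1 := Set.Ioo_subset_Icc_self hs₀
  have hρtop : top 1 = ρ := hB.top_eq h1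
    (Conley.isFlowSup_one h hN (hM 1 h1) hρ fun n => hc _ (hε n))
  have hπbot : bot 0 = π := hB.bot_eq h0
    (Conley.isFlowInf_zero h hN (hM 0 h0) hπ fun n => hc _ (hε n))
  obtain ⟨m, γ, hγ0, hγmem, hγstep, hγlast⟩ := hB.exists_right_chain h hs₀ hD.right
  obtain ⟨m', γ', hγ'0, hγ'mem, hγ'step, hγ'last⟩ := hB.exists_left_chain h hs₀ hD.left
  have hR : ∀ i ≤ m, γ i ∈ Set.Icc (0 : ℝ) 1 := fun i hi =>
    ⟨hs₀.1.le.trans (hγmem i hi).1.le, (hγmem i hi).2⟩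
  have hL : ∀ i ≤ m', γ' i ∈ Set.Icc (0 : ℝ) 1 := fun i hi =>
    ⟨(hγ'mem i hi).1, (hγ'mem i hi).2.le.trans hs₀.2.le⟩
  -- The right chain occupies positions `0` to `m`, `s₀` position `m + 1`, and the left chain is
  -- read backwards, its `j`-th entry at `m + m' + 2 - j`. A label is the constant value between two
  -- consecutive parameters: `bot` of the right end or `top` of the left end, with `ρ` and `π` added
  -- outside.
  let Γ : ℕ → ℝ := fun i => if i ≤ m then γ i else if i = m + 1 then s₀ else γ' (m + m' + 2 - i)
  let Ξ : ℕ → ι := fun i => if i = 0 then ρ else if i ≤ m + 1 then bot (γ (i - 1))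
    else if i ≤ m + m' + 2 then top (γ' (m + m' + 2 - i)) else π
  have hΓ₁ : ∀ i ≤ m, Γ i = γ i := fun i hi => by simp [Γ, hi]
  have hΓ₂ : Γ (m + 1) = s₀ := by simp [Γ]
  have hΓ₃ : ∀ j ≤ m', Γ (m + m' + 2 - j) = γ' j := fun j hj => by
    have h₁ : ¬ m + m' + 2 - j ≤ m := by omega
    have h₂ : ¬ m + m' + 2 - j = m + 1 := by omega
    have h₃ : m + m' + 2 - (m + m' + 2 - j) = j := by omega
    simp only [Γ, h₁, h₂, h₃, if_false]
  have hΞ₀ : Ξ 0 = ρ := by simp [Ξ]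
  have hΞ₁ : ∀ i ≤ m, Ξ (i + 1) = bot (γ i) := fun i hi => by simp [Ξ, hi]
  have hΞ₂ : ∀ j ≤ m', Ξ (m + m' + 2 - j) = top (γ' j) := fun j hj => by
    have h₁ : ¬ m + m' + 2 - j = 0 := by omega
    have h₂ : ¬ m + m' + 2 - j ≤ m + 1 := by omega
    have h₃ : m + m' + 2 - (m + m' + 2 - j) = j := by omega
    have h₄ : m + m' + 2 - j ≤ m + m' + 2 := by omega
    simp only [Ξ, h₁, h₂, h₃, h₄, if_false, if_true]
  have hΞ₃ : Ξ (m + m' + 3) = π := by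
    have h₂ : ¬ m + m' + 3 ≤ m + 1 := by omega
    simp [Ξ, h₂]
  have hΞl : Ξ (m + 1) = bot (γ m) := hΞ₁ m le_rfl
  have hΞl' : Ξ (m + 2) = top (γ' m') := by
    rw [← hΞ₂ m' le_rfl]; congr 1; omega
  have hγm := hγmem m le_rfl
  have hγ'm := hγ'mem m' le_rfl
  have hright : Conley.IsOneSidedApproach N φ D C (Set.Ioc s₀ 1) s₀ (Ξ (m + 1)) (top s₀) :=
    hΞl ▸ hB.approach_right h hs₀ hD.right hγm (hB.bot_mem (hR m le_rfl)) hγlast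
  have hleft : Conley.IsOneSidedApproach N φ D C (Set.Ico 0 s₀) s₀ (Ξ (m + 2)) (bot s₀) :=
    hΞl' ▸ hB.approach_left h hs₀ hD.left hγ'm (hB.top_mem (hL m' le_rfl)) hγ'last
  have hidx1 : ∀ i ≤ m, (D (γ i)).idx = (D 1).idx := fun i hi =>
    hD.right.idx_eq (hγmem i hi) ⟨hs₀.2, le_rfl⟩
  have hidx0 : ∀ i ≤ m', (D (γ' i)).idx = (D 0).idx := fun i hi =>
    hD.left.idx_eq (hγ'mem i hi) ⟨le_rfl, hs₀.1⟩
  refine ⟨m + 1, m + m' + 1, Γ, Ξ, top s₀, bot s₀, by omega, by omega, ?_, hΓ₂, ?_, ?_, ?_, ?_,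
    hB.top_mem hs₀', hB.bot_mem hs₀', ?_, hB.bot_le_top hs₀', hΞ₀, ?_, ?_, ?_, ?_, hΞ₃,
    fun L hL => hright.inter_nonempty hL, fun L hL => hleft.inter_nonempty hL,
    fun i K a b hi hK => hright.pair_inclusions hf hφ hI hK.isClosed (hK.eventually_right hi),
    fun i K a b hi hK => hleft.pair_inclusions hf hφ hI hK.isClosed (hK.eventually_left hi)⟩
  · rw [hΓ₁ 0 (Nat.zero_le m), hγ0]
  · exact (hΓ₃ 0 (Nat.zero_le m')).trans hγ'0
  · intro i hi
    rcases lt_trichotomy i m with him | him | him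
    · rw [hΓ₁ i him.le, hΓ₁ (i + 1) him]
      exact (hγstep i him).1
    · rw [him, hΓ₂, hΓ₁ m le_rfl]
      exact hγm.1
    · obtain ⟨j, hj, hij⟩ : ∃ j ≤ m', i + 1 = m + m' + 2 - j :=
        ⟨m + m' + 1 - i, by omega, by omega⟩
      rw [hij, hΓ₃ j hj]
      rcases hj.lt_or_eq with hjm | hjm
      · rw [show i = m + m' + 2 - (j + 1) by omega, hΓ₃ (j + 1) hjm]
        exact (hγ'step j hjm).1
      · rw [show i = m + 1 by omega, hΓ₂]
        exact (hγ'mem j hj).2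
  · rintro (_ | i) hi
    · rw [hΞ₀]
      exact hρ
    · have hi' : i ≤ m := by omega
      rw [hΞ₁ i hi', ← hidx1 i hi']
      exact hB.bot_mem (hR i hi')
  · intro i hi hi'
    rcases hi'.lt_or_eq with hlt | heq
    · obtain ⟨j, hj, hij⟩ : ∃ j ≤ m', i = m + m' + 2 - j :=
        ⟨m + m' + 2 - i, by omega, by omega⟩
      rw [hij, hΞ₂ j hj, ← hidx0 j hj]
      exact hB.top_mem (hL j hj)
    · rw [heq]
      exact hΞ₃ ▸ hπ
  -- At a jump the incoming label is the `top` and the outgoing one the `bot` of the same slice, so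
  -- the strict relation is `bot_lt_top`.
  · intro i hi₁ hik hil
    rcases lt_or_gt_of_ne hil with him | him
    · obtain ⟨j, rfl⟩ : ∃ j, i = j + 1 := ⟨i - 1, by omega⟩
      have hj : j < m := by omega
      obtain ⟨-, heq, hne⟩ := hγstep j hj
      rw [hΓ₁ (j + 1) hj, hΞ₁ (j + 1) hj, hΞ₁ j hj.le, heq]
      exact hB.bot_lt_top (hR (j + 1) hj) hne
    · obtain ⟨j, hj, hij⟩ : ∃ j < m', i = m + m' + 2 - (j + 1) :=
        ⟨m + m' + 1 - i, by omega, by omega⟩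
      obtain ⟨-, heq, hne⟩ := hγ'step j hj
      rw [show i + 1 = m + m' + 2 - j by omega, hij, hΓ₃ (j + 1) hj, hΞ₂ (j + 1) hj,
        hΞ₂ j hj.le, heq]
      exact hB.bot_lt_top (hL (j + 1) hj) hne
  · rw [hΞ₀, ← hρtop]
    exact hB.sup 1 h1
  · rw [hΞ₁ 0 (Nat.zero_le m), hγ0]
    exact hB.inf 1 h1
  · have : Ξ (m + m' + 1 + 1) = top 0 := (hΞ₂ 0 (Nat.zero_le m')).trans (by rw [hγ'0])
    rw [this]
    exact hB.sup 0 h0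
  · have : Ξ (m + m' + 1 + 2) = bot 0 := hΞ₃.trans hπbot.symm
    rw [this]
    exact hB.inf 0 h0
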